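/- For each $\ell\in\mathbb N$ let $(Y_{\ell,m})_{-\ell\le m\le\ell}$ be a basis of the space of real spherical harmonics of degree $\ell$ on $\mathbb S^2\subset\mathbb R^3$ that is orthonormal in $L^2(\mathbb S^2)$ (surface measure, total mass $4\pi$). For $p\ge 0$ let $$\mathcal H_p=\Big\{f\in L^2(\mathbb S^2):\ \sum_{\ell\ge0}(1+\ell(\ell+1))^p\sum_{m=-\ell}^{\ell}\langle f,Y_{\ell,m}\rangle^2<\infty\Big\}.$$ Let $p>1$, and let $\mathscr D$ be an admissible operator with spectral growth order $p$, i.e. $\mathscr Df=\sum_\ell D_\ell\sum_m\langle f,Y_{\ell,m}\rangle Y_{\ell,m}$ with non-zero real $D_\ell$ such that, for some constants $C_1,C_2>0$, $C_1(1+\ell)^p\le|D_\ell|\le C_2(1+\ell)^p$ for all $\ell$; for $f\in\mathcal H_p$ the series converges in $L^2(\mathbb S^2)$. Every $f\in\mathcal H_p$ has a unique continuous representative, and $f(u)$ denotes its value at $u$. There is a unique continuous function $\psi=\psi_{\mathscr D^*\mathscr D}:[-1,1]\to\mathbb R$, the zonal Green's kernel of $\mathscr D^*\mathscr D$, such that for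 every $u\in\mathbb S^2$ the function $\psi(\langle\cdot,u\rangle)$ is the Green's function $(\mathscr D^*\mathscr D)^{-1}\delta_u$, i.e. $\int_{\mathbb S^2}\psi(\langle v,u\rangle)\varphi(v)\,dv=\big((\mathscr D^*\mathscr D)^{-1}\varphi\big)(u)$ for all $\varphi\in\bigcap_{q\ge0}\mathcal H_q$, where $(\mathscr D^*\mathscr D)^{-1}\varphi=\sum_\ell D_\ell^{-2}\sum_m\langle\varphi,Y_{\ell,m}\rangle Y_{\ell,m}$. Let $n\ge1$, $r_1,\dots,r_n\ge1$, $w_{ij}\in\mathbb R$ and pairwise distinct $u_{ij}\in\mathbb S^2$ ($1\le i\le n$, $1\le j\le r_i$), and let $\eta>0$. Then the problem $$\min_{f\in\mathcal H_p}\ \frac{4\pi}{n}\sum_{i=1}^n\frac1{r_i}\sum_{j=1}^{r_i}\big(w_{ij}-f(u_{ij})\big)^2+\eta\,\|\mathscr Df\|_{L^2(\mathbb S^2)}^2$$ has a unique solution $\mu_\eta\in\mathcal H_p$, and it is of the form $$\mu_\eta=\sum_{i=1}^n\frac1{\sqrt{r_i}}\sum_{j=1}^{r_i}\alpha_{ij}\,\psi(\langle\cdot,u_{ij}\rangle).$$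 Let $L=\sum_i r_i$, let $\boldsymbol y\in\mathbb R^L$ be the vector of the $w_{ij}/\sqrt{r_i}$, and let $\mathbf G\in\mathbb R^{L\times L}$ be the matrix with entries $\psi(\langle u_{i_1j_1},u_{i_2j_2}\rangle)/\sqrt{r_{i_1}r_{i_2}}$, rows and columns being indexed by the pairs $(i,j)$. Then $\mathbf G+\frac{\eta n}{4\pi}\mathbf I_L$ is invertible, and the coefficients $\boldsymbol\alpha=(\alpha_{ij})$ in this representation are uniquely determined and given by $$\boldsymbol\alpha=\Big(\mathbf G+\frac{\eta n}{4\pi}\mathbf I_L\Big)^{-1}\boldsymbol y.$$ -/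

import Mathlib

open MeasureTheory
open scoped RealInnerProductSpace

noncomputable section

namespace SphereMean

/-- The unit sphere of `ℝ³`. -/
abbrev S2 : Type := Metric.sphere (0 : EuclideanSpace ℝ (Fin 3)) 1

/-- The surface measure of the unit sphere (total mass `4π`). -/
abbrev surf : Measure S2 := (volume : Measure (EuclideanSpace ℝ (Fin 3))).toSphere

/-- The Hilbert space of real square-integrable functions on the sphere. -/
abbrev L2 : Type := Lp ℝ 2 surf

/-- The class in `L²` of a continuous function on the sphere. -/
def toL2 (g : C(S2, ℝ)) : L2 := ContinuousMap.toLp (E := ℝ) 2 surf ℝ g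

/-- The value at `u` of the continuous representative of `f`. There is at most one such
representative, because nonempty open sets have positive surface measure; the value is `0` when
there is none. -/
def pointEval (f : L2) (u : S2) : ℝ :=
  open Classical in if h : ∃ g : C(S2, ℝ), toL2 g = f then h.choose u else 0

/-- The space of real spherical harmonics of degree `l`: restrictions to the sphere of the
harmonic homogeneous polynomials of degree `l` in three variables. -/
def sphHarm (l : ℕ) : Submodule ℝ C(S2, ℝ) where
  carrier := {g | ∃ P : MvPolynomial (Fin 3) ℝ, P.IsHomogeneous l ∧
    ∑ i, MvPolynomial.pderiv i (MvPolynomial.pderiv i P) = 0 ∧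
    ∀ x : S2, g x = MvPolynomial.eval (fun i => x.1 i) P}
  zero_mem' := ⟨0, MvPolynomial.isHomogeneous_zero _ _ _, by simp, by simp⟩
  add_mem' := by
    rintro f g ⟨P, hP, hP0, hPe⟩ ⟨Q, hQ, hQ0, hQe⟩
    exact ⟨P + Q, hP.add hQ, by simp [Finset.sum_add_distrib, hP0, hQ0], by simp [hPe, hQe]⟩
  smul_mem' := by
    rintro c f ⟨P, hP, hP0, hPe⟩
    exact ⟨c • P, (MvPolynomial.homogeneousSubmodule (Fin 3) ℝ l).smul_mem c hP,
      by simp [← Finset.smul_sum, hP0], by simp [hPe]⟩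

variable {ι : ℕ → Type} [∀ l, Fintype (ι l)]

/-- For every degree `l`, the family `Y l` is a basis of the space of spherical harmonics of
degree `l` which is orthonormal in `L²`. (That space has dimension `2l+1`, so `ι l` has as many
elements as there are integers `m` with `-l ≤ m ≤ l`.) -/
structure IsHarmonicBasis (Y : ∀ l, ι l → C(S2, ℝ)) : Prop where
  orthonormal : ∀ l, Orthonormal ℝ (fun m => toL2 (Y l m))
  span_eq : ∀ l, Submodule.span ℝ (Set.range (Y l)) = sphHarm l

/-- The spherical Fourier coefficient `f_{l,m} = ⟨f, Y_{l,m}⟩` in `L²`. -/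
def coef (Y : ∀ l, ι l → C(S2, ℝ)) (f : L2) (l : ℕ) (m : ι l) : ℝ :=
  ⟪f, toL2 (Y l m)⟫

/-- The spherical Sobolev space of order `p`, as a subset of `L²`. -/
def sobolev (Y : ∀ l, ι l → C(S2, ℝ)) (p : ℝ) : Set L2 :=
  {f | Summable fun l : ℕ => (1 + (l : ℝ) * (l + 1)) ^ p * ∑ m, coef Y f l m ^ 2}

/-- The space of smooth functions on the sphere: the intersection of all Sobolev spaces. -/
def smooth (Y : ∀ l, ι l → C(S2, ℝ)) : Set L2 := ⋂ p : {p : ℝ // 0 ≤ p}, sobolev Y p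

/-- `D` is the sequence of spherical Fourier coefficients of an admissible operator with
spectral growth order `p`. -/
def IsAdmissible (D : ℕ → ℝ) (p : ℝ) : Prop :=
  0 ≤ p ∧ (∀ l, D l ≠ 0) ∧ ∃ C₁ C₂ : ℝ, 0 < C₁ ∧ 0 < C₂ ∧
    ∀ l : ℕ, C₁ * (1 + (l : ℝ)) ^ p ≤ |D l| ∧ |D l| ≤ C₂ * (1 + (l : ℝ)) ^ p

/-- The operator with spherical Fourier coefficients `D`, that is
`f ↦ ∑_l D_l ∑_m f_{l,m} Y_{l,m}` with convergence in `L²`. For `D` admissible with growth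
order `p` the series converges on the Sobolev space of order `p`, where this is the extension by
continuity of the operator on smooth functions. -/
def op (Y : ∀ l, ι l → C(S2, ℝ)) (D : ℕ → ℝ) (f : L2) : L2 :=
  ∑' l, D l • ∑ m, coef Y f l m • toL2 (Y l m)

/-- The spherical Fourier coefficients of `𝒟* 𝒟`: the adjoint `𝒟*` has the conjugate
coefficients, and composition multiplies the coefficients. -/
def adjMul (D : ℕ → ℝ) (l : ℕ) : ℝ := star (D l) * D l

/-- The Green's function `Ψ_u = 𝒟⁻¹ δ_u` as a distribution: the operator `𝒟⁻¹` (with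
coefficients `1 / D_l`) acts on the Dirac impulse by duality, `⟨𝒟⁻¹ δ_u, φ⟩ = (𝒟⁻¹ φ)(u)`. -/
def greenDist (Y : ∀ l, ι l → C(S2, ℝ)) (D : ℕ → ℝ) (u : S2) (φ : L2) : ℝ :=
  pointEval (op Y (fun l => (D l)⁻¹) φ) u

/-- The inner product `⟨u, v⟩` of two points of the sphere, as a point of `[-1, 1]`. -/
def dot (u v : S2) : Set.Icc (-1 : ℝ) 1 :=
  ⟨⟪(u : EuclideanSpace ℝ (Fin 3)), (v : EuclideanSpace ℝ (Fin 3))⟫, by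
    have h := abs_real_inner_le_norm (u : EuclideanSpace ℝ (Fin 3)) v
    simp only [norm_eq_of_mem_sphere, mul_one] at h
    exact abs_le.mp h⟩

/-- The zonal function `v ↦ ψ(⟨v, u⟩)` centred at `u`. -/
def zonal (ψ : C(Set.Icc (-1 : ℝ) 1, ℝ)) (u : S2) : C(S2, ℝ) where
  toFun v := ψ (dot v u)
  continuous_toFun := ψ.continuous.comp
    (Continuous.subtype_mk (continuous_subtype_val.inner continuous_const) _)

/-- `ψ` is the (continuous) zonal Green's kernel of the operator with coefficients `D`: for every
`u`, the function `v ↦ ψ(⟨v, u⟩)` is the Green's function at `u`, tested on smooth functions. -/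
def IsZonalGreenKernel (Y : ∀ l, ι l → C(S2, ℝ)) (D : ℕ → ℝ)
    (ψ : C(Set.Icc (-1 : ℝ) 1, ℝ)) : Prop :=
  ∀ u : S2, ∀ φ ∈ smooth Y, ∫ v, zonal ψ u v * φ v ∂surf = greenDist Y D u φ

/-- The penalized least-squares functional
`(4π/n) ∑_i (1/r_i) ∑_j (w_ij - f(u_ij))² + η ‖𝒟 f‖²`. -/
def cost (Y : ∀ l, ι l → C(S2, ℝ)) (D : ℕ → ℝ) {n : ℕ} {r : Fin n → ℕ}
    (w : ∀ i, Fin (r i) → ℝ) (u : ∀ i, Fin (r i) → S2) (η : ℝ) (f : L2) : ℝ :=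
  4 * Real.pi / n * ∑ i, 1 / (r i : ℝ) * ∑ j, (w i j - pointEval f (u i j)) ^ 2
    + η * ‖op Y D f‖ ^ 2

/-- The normalized Gram matrix `ψ(⟨u_{i₁j₁}, u_{i₂j₂}⟩) / √(r_{i₁} r_{i₂})`, with rows and columns
indexed by the pairs `(i, j)`. -/
def gram (ψ : C(Set.Icc (-1 : ℝ) 1, ℝ)) {n : ℕ} {r : Fin n → ℕ} (u : ∀ i, Fin (r i) → S2) :
    Matrix (Σ i, Fin (r i)) (Σ i, Fin (r i)) ℝ :=
  Matrix.of fun a b => ψ (dot (u a.1 a.2) (u b.1 b.2)) / √((r a.1 : ℝ) * r b.1)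

/-- The normalized observations `w_ij / √r_i`, indexed by the pairs `(i, j)`. -/
def obs {n : ℕ} {r : Fin n → ℕ} (w : ∀ i, Fin (r i) → ℝ) : (Σ i, Fin (r i)) → ℝ :=
  fun a => w a.1 a.2 / √(r a.1 : ℝ)

/-- The spline `∑_i r_i^{-1/2} ∑_j α_ij ψ(⟨·, u_ij⟩)`. -/
def spline (ψ : C(Set.Icc (-1 : ℝ) 1, ℝ)) {n : ℕ} {r : Fin n → ℕ} (u : ∀ i, Fin (r i) → S2)
    (α : (Σ i, Fin (r i)) → ℝ) : C(S2, ℝ) :=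
  ∑ i, (1 / √(r i : ℝ)) • ∑ j, α ⟨i, j⟩ • zonal ψ (u i j)

end SphereMean

end

open SphereMean

/-!
The argument has two layers: harmonic analysis on the sphere, and a representer theorem in the
resulting reproducing kernel Hilbert space.

**Harmonic analysis.** Surface measure is rotation invariant; differentiating this invariance shows
that the angular derivatives `x_i ∂_j - x_j ∂_i` are skew-symmetric in `L²`. The sum of their
squares acts on solid harmonics of degree `l` as `-l(l+1)`, so harmonics of different degrees are
orthogonal (`integral_mul_eq_zero_of_mem_sphHarm`). If `P` is a solid harmonic of degree `l`, then
`x_i P - |x|² ∂_i P / (2l+1)` is one of degree `l + 1`, so the span of the spherical harmonics is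
stable under multiplication by coordinates and contains all polynomials; by Stone-Weierstrass it is
uniformly dense (`topologicalClosure_iSup_sphHarm`). Hence the `Y l m` form a Hilbert basis of `L²`.
The space of harmonics of degree `l` has dimension at most `2l+1`, and its reproducing kernel
`∑_m Y_{l,m}(u) Y_{l,m}(v)` is invariant under isometries, because these act on the `Y l m` by an
orthogonal matrix. It is therefore a function of `⟨u, v⟩`, with constant diagonal of size `O(l)`
(`IsHarmonicBasis.harmKernel_act`, `IsHarmonicBasis.harmKernel_self_le`). No explicit form of the
addition theorem in terms of Legendre polynomials is needed.

**Point evaluation and the Green's kernel.** By the Cauchy-Schwarz inequality and the bound on the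
diagonal, spherical Fourier series in the Sobolev space of order `p > 1` converge uniformly
(`summable_harmonics`), as `∑ (2l+1)(1+l)^{-2p} < ∞`. In particular
`∑_l D_l^{-2} ∑_m Y_{l,m}(u) Y_{l,m}(v)` converges to a continuous function of `⟨u, v⟩`, the zonal
Green's kernel, and a continuous `ψ` is the kernel exactly when its zonal functions have these
Fourier coefficients (`isZonalGreenKernel_iff`).

**Representer theorem.** The zonal functions reproduce point values for the inner product
`⟨𝒟 f, 𝒟 g⟩` (`inner_op_spline`). Consequently the Gram matrix is positive semidefinite, so that
adding a positive multiple of the identity makes it invertible, and if `α` solves the linear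
system, completing the square shows that the cost at `μ + h` exceeds that at the spline `μ` by a
quadratic form in `h` which is at least `η ‖𝒟 h‖²` (`cost_spline_add`). This gives existence and
uniqueness of the minimizer. The coefficients are unique because a combination of point
evaluations at distinct points which kills all spherical harmonics kills all continuous functions
(`eq_zero_of_sum_harmonics_eq_zero`).
-/

noncomputable section

namespace SphereMean

section Polynomials

open MvPolynomial
open scoped Pointwise

/-! ### Rotations and angular derivatives -/

/-- The action of a linear isometry of `ℝ³` on the unit sphere. -/
def act (R : EuclideanSpace ℝ (Fin 3) ≃ₗᵢ[ℝ] EuclideanSpace ℝ (Fin 3)) (x : S2) : S2 :=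
  ⟨R x, by simp [norm_eq_of_mem_sphere]⟩

theorem continuous_act (R : EuclideanSpace ℝ (Fin 3) ≃ₗᵢ[ℝ] EuclideanSpace ℝ (Fin 3)) :
    Continuous (act R) :=
  (R.continuous.comp continuous_subtype_val).subtype_mk _

/-- Surface measure is invariant under isometries, since it is defined through the volume of
truncated cones. -/
theorem measurePreserving_act
    (R : EuclideanSpace ℝ (Fin 3) ≃ₗᵢ[ℝ] EuclideanSpace ℝ (Fin 3)) :
    MeasurePreserving (act R) surf surf := by
  refine ⟨(continuous_act R).measurable, ?_⟩
  ext s hs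
  rw [Measure.map_apply (continuous_act R).measurable hs,
    Measure.toSphere_apply' _ hs,
    Measure.toSphere_apply' _ ((continuous_act R).measurable hs)]
  congr 1
  have h : Set.Ioo (0 : ℝ) 1 • ((↑) '' (act R ⁻¹' s) : Set (EuclideanSpace ℝ (Fin 3))) =
      R ⁻¹' (Set.Ioo (0 : ℝ) 1 • ((↑) '' s)) := by
    ext x
    simp only [Set.mem_smul, Set.mem_image, Set.mem_preimage]
    constructor
    · rintro ⟨t, ht, _, ⟨y, hy, rfl⟩, rfl⟩
      exact ⟨t, ht, _, ⟨_, hy, rfl⟩, by simp [act]⟩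
    · rintro ⟨t, ht, _, ⟨y, hy, rfl⟩, hx⟩
      refine ⟨t, ht, _, ⟨act R.symm y, ?_, rfl⟩, R.injective (by simp [act, hx])⟩
      convert hy
      ext1
      simp [act]
  rw [h, R.measurePreserving.measure_preimage_emb R.toHomeomorph.measurableEmbedding]

theorem integral_comp_act (R : EuclideanSpace ℝ (Fin 3) ≃ₗᵢ[ℝ] EuclideanSpace ℝ (Fin 3))
    (f : C(S2, ℝ)) : ∫ x, f (act R x) ∂surf = ∫ x, f x ∂surf := by
  conv_rhs => rw [← (measurePreserving_act R).map_eq]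
  rw [integral_map (continuous_act R).aemeasurable f.continuous.aestronglyMeasurable]

theorem integrable_continuousMap (f : C(S2, ℝ)) : Integrable f surf :=
  f.continuous.integrable_of_hasCompactSupport (HasCompactSupport.of_compactSpace _)

/-- Restriction of polynomials in three variables to the sphere. -/
def restr : MvPolynomial (Fin 3) ℝ →ₐ[ℝ] C(S2, ℝ) :=
  aeval fun i => ⟨fun x => x.1 i, by fun_prop⟩

theorem restr_apply (P : MvPolynomial (Fin 3) ℝ) (x : S2) :
    restr P x = eval (fun i => x.1 i) P := by
  induction P using MvPolynomial.induction_on with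
  | C a => simp [restr]
  | add p q hp hq => simp [hp, hq]
  | mul_X p i hp => rw [map_mul, ContinuousMap.mul_apply, hp]; simp [restr]

theorem integral_restr_add (P Q : MvPolynomial (Fin 3) ℝ) :
    ∫ x, restr (P + Q) x ∂surf = ∫ x, restr P x ∂surf + ∫ x, restr Q x ∂surf := by
  simp only [map_add, ContinuousMap.add_apply]
  exact integral_add (integrable_continuousMap _) (integrable_continuousMap _)

theorem mem_sphHarm {l : ℕ} {g : C(S2, ℝ)} : g ∈ sphHarm l ↔
    ∃ P : MvPolynomial (Fin 3) ℝ, P.IsHomogeneous l ∧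
      ∑ i, pderiv i (pderiv i P) = 0 ∧ g = restr P := by
  refine exists_congr fun P => and_congr_right fun _ => and_congr_right fun _ => ?_
  rw [ContinuousMap.ext_iff]
  exact forall_congr' fun x => by rw [restr_apply]

theorem pderiv_pderiv_comm {σ : Type*} (i j : σ) (P : MvPolynomial σ ℝ) :
    pderiv i (pderiv j P) = pderiv j (pderiv i P) := by
  classical
  -- the commutator is a derivation, hence determined by its values on the variables
  have h : ⁅pderiv i, pderiv j⁆ = (0 : Derivation ℝ (MvPolynomial σ ℝ) _) :=
    derivation_ext fun k => by
      rw [Derivation.commutator_apply]; simp [Pi.single_apply, apply_ite]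
  have := congrArg (fun d => d P) h
  simpa [Derivation.commutator_apply, sub_eq_zero] using this

/-- The angular derivative `x_i ∂_j - x_j ∂_i`, the generator of the rotations in the
`(i, j)`-plane. -/
def rotDeriv (i j : Fin 3) : Derivation ℝ (MvPolynomial (Fin 3) ℝ) (MvPolynomial (Fin 3) ℝ) :=
  (X i : MvPolynomial (Fin 3) ℝ) • pderiv j - (X j : MvPolynomial (Fin 3) ℝ) • pderiv i

/-- The rotation by the angle `t` in the `(i, j)`-plane. -/
def planeRot (i j : Fin 3) (hij : i ≠ j) (t : ℝ) :
    EuclideanSpace ℝ (Fin 3) ≃ₗᵢ[ℝ] EuclideanSpace ℝ (Fin 3) :=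
  LinearIsometry.toLinearIsometryEquiv
    { toFun := fun x => WithLp.toLp 2 fun k =>
        if k = i then Real.cos t * x i - Real.sin t * x j
        else if k = j then Real.sin t * x i + Real.cos t * x j else x k
      map_add' := fun x y => by
        ext k; simp only [PiLp.add_apply]; split_ifs <;> ring
      map_smul' := fun c x => by
        ext k; simp only [PiLp.smul_apply, smul_eq_mul, RingHom.id_apply]; split_ifs <;> ring
      norm_map' := fun x => by
        have h := Real.sin_sq_add_cos_sq t
        simp only [LinearMap.coe_mk, AddHom.coe_mk, EuclideanSpace.norm_eq, Real.norm_eq_abs,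
          sq_abs]
        congr 1
        fin_cases i <;> fin_cases j <;> simp [Fin.sum_univ_three] at hij ⊢ <;>
          first
            | linear_combination (x 0 ^ 2 + x 1 ^ 2) * h
            | linear_combination (x 0 ^ 2 + x 2 ^ 2) * h
            | linear_combination (x 1 ^ 2 + x 2 ^ 2) * h } rfl

theorem planeRot_apply (i j : Fin 3) (hij : i ≠ j) (t : ℝ) (x : EuclideanSpace ℝ (Fin 3))
    (k : Fin 3) : planeRot i j hij t x k =
      if k = i then Real.cos t * x i - Real.sin t * x j
        else if k = j then Real.sin t * x i + Real.cos t * x j else x k := rfl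

theorem hasDerivAt_eval_planeRot (i j : Fin 3) (hij : i ≠ j) (x : EuclideanSpace ℝ (Fin 3))
    (P : MvPolynomial (Fin 3) ℝ) (t : ℝ) :
    HasDerivAt (fun t => eval (fun k => planeRot i j hij t x k) P)
      (eval (fun k => planeRot i j hij t x k) (rotDeriv i j P)) t := by
  induction P using MvPolynomial.induction_on with
  | C a => simpa [rotDeriv] using hasDerivAt_const t a
  | add p q hp hq => simpa only [map_add] using! hp.add hq
  | mul_X p k hp =>
    have hk : HasDerivAt (fun t => planeRot i j hij t x k)
        (eval (fun k => planeRot i j hij t x k) (rotDeriv i j (X k))) t := by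
      simp only [planeRot_apply]
      rcases eq_or_ne k i with rfl | hki
      · convert! ((Real.hasDerivAt_cos t).mul_const (x k)).sub
          ((Real.hasDerivAt_sin t).mul_const (x j)) using 1
        · ext; simp
        · simp [rotDeriv, pderiv_X, hij, hij.symm]
          ring
      rcases eq_or_ne k j with rfl | hkj
      · convert! ((Real.hasDerivAt_sin t).mul_const (x i)).add
          ((Real.hasDerivAt_cos t).mul_const (x k)) using 1
        · ext; simp [hki]
        · simp [rotDeriv, pderiv_X, hij.symm]
          ring
      · simpa [rotDeriv, pderiv_X, Pi.single_apply, hki, hkj] using hasDerivAt_const t (x k)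
    convert! hp.mul hk using 1
    · ext; simp
    · simp [Derivation.leibniz]; ring

/-- Angular derivatives have mean zero: the mean of a polynomial over the sphere does not change
under rotations, and its derivative at the angle `0` is the mean of the angular derivative. -/
theorem integral_rotDeriv (i j : Fin 3) (hij : i ≠ j) (P : MvPolynomial (Fin 3) ℝ) :
    ∫ x, restr (rotDeriv i j P) x ∂surf = 0 := by
  have e (Q : MvPolynomial (Fin 3) ℝ) (t : ℝ) (x : S2) :
      eval (fun k => planeRot i j hij t x k) Q = restr Q (act (planeRot i j hij t) x) := by
    rw [restr_apply]; rfl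
  -- The derivative at `t` is a fixed continuous function evaluated at the rotated point,
  -- which bounds it uniformly.
  have h := (hasDerivAt_integral_of_dominated_loc_of_deriv_le (μ := surf) (s := Set.univ)
    (F := fun t (x : S2) => restr P (act (planeRot i j hij t) x))
    (F' := fun t (x : S2) => restr (rotDeriv i j P) (act (planeRot i j hij t) x))
    (x₀ := 0) (bound := fun _ => ‖restr (rotDeriv i j P)‖) Filter.univ_mem
    (.of_forall fun t =>
      ((restr P).continuous.comp (continuous_act _)).aestronglyMeasurable)
    (integrable_continuousMap ((restr P).comp ⟨_, continuous_act _⟩))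
    ((restr _).continuous.comp (continuous_act _)).aestronglyMeasurable
    (.of_forall fun x t _ => (restr (rotDeriv i j P)).norm_coe_le_norm _)
    (integrable_const _)
    (.of_forall fun x t _ => by
      simp only [← e]
      exact hasDerivAt_eval_planeRot i j hij x P t)).2
  simp only [integral_comp_act] at h
  exact h.unique (hasDerivAt_const _ _)

/-- The square of an angular derivative is symmetric in `L²`. -/
theorem integral_rotDeriv_mul (i j : Fin 3) (hij : i ≠ j) (P Q : MvPolynomial (Fin 3) ℝ) :
    ∫ x, restr (rotDeriv i j (rotDeriv i j P) * Q) x ∂surf =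
      ∫ x, restr (P * rotDeriv i j (rotDeriv i j Q)) x ∂surf := by
  have h := integral_rotDeriv i j hij (Q * rotDeriv i j P - P * rotDeriv i j Q)
  have e : rotDeriv i j (Q * rotDeriv i j P - P * rotDeriv i j Q) =
      rotDeriv i j (rotDeriv i j P) * Q - P * rotDeriv i j (rotDeriv i j Q) := by
    simp only [map_sub, Derivation.leibniz, smul_eq_mul]; ring
  rw [e, map_sub] at h
  simp only [ContinuousMap.sub_apply] at h
  rwa [integral_sub (integrable_continuousMap _) (integrable_continuousMap _), sub_eq_zero] at h

/-- A harmonic homogeneous polynomial of degree `l` is an eigenvector of the angular Laplacian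
for the eigenvalue `-l(l+1)`. -/
theorem sum_rotDeriv_rotDeriv {l : ℕ} {P : MvPolynomial (Fin 3) ℝ} (hP : P.IsHomogeneous l)
    (h0 : ∑ i, pderiv i (pderiv i P) = 0) :
    rotDeriv 0 1 (rotDeriv 0 1 P) + rotDeriv 0 2 (rotDeriv 0 2 P) +
      rotDeriv 1 2 (rotDeriv 1 2 P) = -((l : MvPolynomial (Fin 3) ℝ) * (l + 1)) * P := by
  -- With the Euler operator `E`, the sum of the squares is `|x|² Δ - E² - E`, and Euler's identity
  -- gives `E P = l P`; `E² P` is computed from the derivatives of that identity.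
  have hE := hP.sum_X_mul_pderiv
  have d (k : Fin 3) := congrArg (pderiv k) hE
  have d0 := d 0
  have d1 := d 1
  have d2 := d 2
  have c10 := pderiv_pderiv_comm 1 0 P
  have c20 := pderiv_pderiv_comm 2 0 P
  have c21 := pderiv_pderiv_comm 2 1 P
  simp [Fin.sum_univ_three, pderiv_X] at hE d0 d1 d2 h0
  simp [rotDeriv, pderiv_X, c10, c20, c21] at d0 d1 d2 ⊢
  linear_combination (X 0 ^ 2 + X 1 ^ 2 + X 2 ^ 2) * h0 - X 0 * d0 - X 1 * d1 - X 2 * d2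
    - (l + 1) * hE

theorem integral_mul_eq_zero_of_mem_sphHarm {l k : ℕ} (hlk : l ≠ k) {f g : C(S2, ℝ)}
    (hf : f ∈ sphHarm l) (hg : g ∈ sphHarm k) : ∫ x, f x * g x ∂surf = 0 := by
  obtain ⟨P, hP, hP0, rfl⟩ := mem_sphHarm.1 hf
  obtain ⟨Q, hQ, hQ0, rfl⟩ := mem_sphHarm.1 hg
  have key : ∫ x, restr ((-((l : MvPolynomial (Fin 3) ℝ) * (l + 1)) * P) * Q) x ∂surf =
      ∫ x, restr (P * (-((k : MvPolynomial (Fin 3) ℝ) * (k + 1)) * Q)) x ∂surf := by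
    rw [← sum_rotDeriv_rotDeriv hP hP0, ← sum_rotDeriv_rotDeriv hQ hQ0]
    simp only [add_mul, mul_add, integral_restr_add]
    rw [integral_rotDeriv_mul _ _ (by decide), integral_rotDeriv_mul _ _ (by decide),
      integral_rotDeriv_mul _ _ (by decide)]
  have e1 (x : S2) : restr ((-((l : MvPolynomial (Fin 3) ℝ) * (l + 1)) * P) * Q) x =
      -((l : ℝ) * (l + 1)) * (restr P x * restr Q x) := by
    simp [restr_apply]; ring
  have e2 (x : S2) : restr (P * (-((k : MvPolynomial (Fin 3) ℝ) * (k + 1)) * Q)) x =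
      -((k : ℝ) * (k + 1)) * (restr P x * restr Q x) := by
    simp [restr_apply]; ring
  simp only [e1, e2, integral_const_mul] at key
  have hne : (l : ℝ) * (l + 1) - k * (k + 1) ≠ 0 := by
    have h1 : (l : ℝ) - k ≠ 0 := sub_ne_zero.2 (by exact_mod_cast hlk)
    have h2 : (l : ℝ) + k + 1 ≠ 0 := by positivity
    convert! mul_ne_zero h1 h2 using 1
    ring
  refine (mul_eq_zero.1 ?_).resolve_left hne
  linear_combination -key

/-! ### Density of the spherical harmonics -/

/-- The product of a coordinate and a solid harmonic of degree `l` is, on the sphere, the sum of a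
spherical harmonic of degree `l + 1` and one of degree `l - 1`. -/
theorem restr_X_mul_mem {l : ℕ} {P : MvPolynomial (Fin 3) ℝ} (hP : P.IsHomogeneous l)
    (h0 : ∑ i, pderiv i (pderiv i P) = 0) (i : Fin 3) :
    restr (X i * P) ∈ ⨆ l, sphHarm l := by
  have hl : (2 * (l : ℝ) + 1) ≠ 0 := by positivity
  set N : MvPolynomial (Fin 3) ℝ := X 0 ^ 2 + X 1 ^ 2 + X 2 ^ 2 with hN
  set Q : MvPolynomial (Fin 3) ℝ := X i * P - C (2 * (l : ℝ) + 1)⁻¹ * (N * pderiv i P) with hQ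
  have hNh : N.IsHomogeneous 2 :=
    (((isHomogeneous_X_pow _ _).add (isHomogeneous_X_pow _ _)).add (isHomogeneous_X_pow _ _))
  have hQh : Q.IsHomogeneous (l + 1) := by
    refine IsHomogeneous.sub ?_ ?_
    · rw [add_comm]
      exact (isHomogeneous_X ℝ i).mul hP
    · -- in degree `0` the derivative vanishes, and the truncated degree `l - 1` is harmless
      rcases l with _ | l
      · rw [← totalDegree_zero_iff_isHomogeneous, totalDegree_eq_zero_iff_eq_C] at hP
        rw [hP, pderiv_C, mul_zero, mul_zero]
        exact isHomogeneous_zero _ _ _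
      · have := (isHomogeneous_C (Fin 3) (2 * ((l + 1 : ℕ) : ℝ) + 1)⁻¹).mul
          (hNh.mul (hP.pderiv (i := i)))
        convert! this using 1
        simp; ring
  have hRh : ∑ k, pderiv k (pderiv k (pderiv i P)) = 0 := by
    have := congrArg (pderiv i) h0
    simpa [pderiv_pderiv_comm i] using this
  have hQ0 : ∑ k, pderiv k (pderiv k Q) = 0 := by
    have d := congrArg (pderiv i) hP.sum_X_mul_pderiv
    have hc : (C (2 * (l : ℝ) + 1)⁻¹ : MvPolynomial (Fin 3) ℝ) * (2 * l + 1) = 1 := by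
      rw [show (2 * l + 1 : MvPolynomial (Fin 3) ℝ) = C (2 * (l : ℝ) + 1) by
          rw [map_add, map_mul, map_natCast, map_one, map_ofNat], ← C_mul,
        inv_mul_cancel₀ hl, C_1]
    set c : MvPolynomial (Fin 3) ℝ := C (2 * (l : ℝ) + 1)⁻¹ with hcdef
    have hcd (k : Fin 3) : pderiv k c = 0 := pderiv_C
    -- `Δ (x_i P) = 2 ∂_i P`, and `Δ (|x|² R) = 6 R + 4 E R` for the harmonic `R = ∂_i P`
    have e1 : ∑ k, pderiv k (pderiv k (X i * P)) = 2 * pderiv i P := by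
      simp only [Fin.sum_univ_three] at h0 ⊢
      fin_cases i <;> simp [pderiv_X] <;> linear_combination (X _) * h0
    -- Euler's identity for `∂_i P`, without the truncated subtraction `l - 1`
    have e2 : pderiv i P + ∑ k, X k * pderiv k (pderiv i P) = l * pderiv i P := by
      simp only [Fin.sum_univ_three] at d ⊢
      have c0 := pderiv_pderiv_comm i 0 P
      have c1 := pderiv_pderiv_comm i 1 P
      have c2 := pderiv_pderiv_comm i 2 P
      fin_cases i <;> simp [pderiv_X] at d c0 c1 c2 ⊢ <;> simp only [*] at d ⊢ <;>
        linear_combination d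
    have e3 : ∑ k, pderiv k (pderiv k (N * pderiv i P)) = (4 * l + 2) * pderiv i P := by
      simp only [Fin.sum_univ_three] at e2 hRh ⊢
      have h2 (k : Fin 3) : pderiv k (2 : MvPolynomial (Fin 3) ℝ) = 0 := by
        exact_mod_cast (pderiv k).map_natCast 2
      simp [hN, pderiv_X, h2]
      linear_combination N * hRh + 4 * e2
    have e4 (R : MvPolynomial (Fin 3) ℝ) (k : Fin 3) :
        pderiv k (pderiv k (c * R)) = c * pderiv k (pderiv k R) := by
      simp [hcd]
    simp only [hQ, map_sub, e4, Finset.sum_sub_distrib, ← Finset.mul_sum, e1, e3]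
    linear_combination -2 * pderiv i P * hc
  have hx : restr (X i * P) = restr Q + (2 * (l : ℝ) + 1)⁻¹ • restr (pderiv i P) := by
    ext x
    have hn : x.1 0 ^ 2 + x.1 1 ^ 2 + x.1 2 ^ 2 = 1 := by
      have := norm_eq_of_mem_sphere x
      rw [EuclideanSpace.norm_eq, Real.sqrt_eq_one] at this
      simpa [Fin.sum_univ_three] using this
    simp [restr_apply, hQ, hN, hn]
  rw [hx]
  exact add_mem (Submodule.mem_iSup_of_mem (l + 1) (mem_sphHarm.2 ⟨Q, hQh, hQ0, rfl⟩))
    (Submodule.smul_mem _ _ (Submodule.mem_iSup_of_mem (l - 1)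
      (mem_sphHarm.2 ⟨_, hP.pderiv, hRh, rfl⟩)))

theorem restr_mem_iSup_sphHarm (P : MvPolynomial (Fin 3) ℝ) : restr P ∈ ⨆ l, sphHarm l := by
  induction P using MvPolynomial.induction_on with
  | C a =>
    exact Submodule.mem_iSup_of_mem 0 (mem_sphHarm.2 ⟨C a, isHomogeneous_C _ _, by simp, rfl⟩)
  | add p q hp hq => rw [map_add]; exact add_mem hp hq
  | mul_X p i hp =>
    rw [map_mul, mul_comm]
    refine Submodule.iSup_induction sphHarm (motive := fun f => restr (X i) * f ∈ _) hp ?_ ?_ ?_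
    · intro l f hf
      obtain ⟨P, hP, hP0, rfl⟩ := mem_sphHarm.1 hf
      rw [← map_mul]
      exact restr_X_mul_mem hP hP0 i
    · simp
    · intro f g hf hg
      rw [mul_add]
      exact add_mem hf hg

theorem topologicalClosure_iSup_sphHarm : (⨆ l, sphHarm l).topologicalClosure = ⊤ := by
  have h := ContinuousMap.subalgebra_topologicalClosure_eq_top_of_separatesPoints restr.range
    (by
      intro x y hxy
      obtain ⟨i, hi⟩ : ∃ i, x.1 i ≠ y.1 i := by
        by_contra! h
        exact hxy (Subtype.ext (by ext i; exact h i))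
      exact ⟨_, ⟨restr (X i), ⟨X i, rfl⟩, rfl⟩, by simpa [restr_apply] using hi⟩)
  rw [eq_top_iff]
  rintro f -
  have hf : f ∈ restr.range.topologicalClosure := h ▸ Algebra.mem_top
  refine closure_mono ?_ hf
  rintro _ ⟨P, rfl⟩
  exact restr_mem_iSup_sphHarm P

variable {ι : ℕ → Type} {Y : ∀ l, ι l → C(S2, ℝ)}

theorem IsHarmonicBasis.mem (hY : IsHarmonicBasis Y) (l : ℕ) (m : ι l) : Y l m ∈ sphHarm l :=
  hY.span_eq l ▸ Submodule.subset_span ⟨m, rfl⟩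

/-- A finite combination of point evaluations which vanishes on all spherical harmonics is
trivial. -/
theorem eq_zero_of_sum_harmonics_eq_zero (hY : IsHarmonicBasis Y) {κ : Type*} [Fintype κ]
    {v : κ → S2} (hv : Function.Injective v) {β : κ → ℝ}
    (h : ∀ l m, ∑ a, β a * Y l m (v a) = 0) : β = 0 := by
  classical
  let Λ : C(S2, ℝ) →L[ℝ] ℝ := ∑ a, β a • ContinuousMap.evalCLM ℝ (v a)
  have hΛ (g : C(S2, ℝ)) : Λ g = ∑ a, β a * g (v a) := by simp [Λ]
  have h1 : (⨆ l, sphHarm l) ≤ Λ.ker := by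
    refine iSup_le fun l => ?_
    rw [← hY.span_eq l, Submodule.span_le]
    rintro _ ⟨m, rfl⟩
    exact (hΛ _).trans (h l m)
  have h2 (g : C(S2, ℝ)) : Λ g = 0 := by
    have h3 := Submodule.topologicalClosure_minimal _ h1 Λ.isClosed_ker
    rw [topologicalClosure_iSup_sphHarm] at h3
    exact h3 (Submodule.mem_top (x := g))
  funext b
  -- a continuous function vanishing at all the points but one
  have h4 := h2 ⟨fun x => ∏ a ∈ Finset.univ.erase b, dist x (v a), by fun_prop⟩
  rw [hΛ, Finset.sum_eq_single b] at h4
  · refine (mul_eq_zero.1 h4).resolve_right ?_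
    refine Finset.prod_ne_zero_iff.2 fun a ha => ?_
    exact dist_ne_zero.2 (hv.ne (Finset.ne_of_mem_erase ha).symm)
  · intro a _ hab
    have : ∏ c ∈ Finset.univ.erase b, dist (v a) (v c) = 0 :=
      Finset.prod_eq_zero (Finset.mem_erase.2 ⟨hab, Finset.mem_univ a⟩) (dist_self _)
    simp [this]
  · simp

/-! ### The dimension of the space of spherical harmonics -/

/-- A harmonic polynomial is determined by its coefficients at the monomials whose exponent in the
last variable is `0` or `1`. -/
theorem eq_zero_of_coeff_eq_zero {P : MvPolynomial (Fin 3) ℝ}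
    (h0 : ∑ i, pderiv i (pderiv i P) = 0) (h : ∀ m : Fin 3 →₀ ℕ, m 2 ≤ 1 → coeff m P = 0) :
    P = 0 := by
  have key : ∀ c : ℕ, ∀ m : Fin 3 →₀ ℕ, m 2 = c → coeff m P = 0 := by
    intro c
    induction c using Nat.strong_induction_on with
    | _ c ih =>
      intro m hm
      rcases le_or_gt c 1 with hc | hc
      · exact h m (hm ▸ hc)
      obtain ⟨m', rfl⟩ : ∃ m' : Fin 3 →₀ ℕ, m = m' + Finsupp.single 2 1 + Finsupp.single 2 1 := by
        refine ⟨m - Finsupp.single 2 2, ?_⟩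
        ext k
        fin_cases k <;> simp
        omega
      -- this coefficient of the Laplacian expresses the coefficient at `m` through two others
      -- whose last exponent is smaller by `2`
      have e := congrArg (coeff m') h0
      simp only [Fin.sum_univ_three, coeff_add, coeff_pderiv, coeff_zero] at e
      simp only [Finsupp.add_apply, Finsupp.single_eq_same] at hm
      rw [ih (m' 2) (by omega) (m' + Finsupp.single 0 1 + Finsupp.single 0 1) (by simp),
        ih (m' 2) (by omega) (m' + Finsupp.single 1 1 + Finsupp.single 1 1) (by simp)] at e
      have p1 : ((m' 2 : ℕ) : ℝ) + 1 ≠ 0 := by positivity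
      have p2 : ((m' 2 : ℕ) : ℝ) + 1 + 1 ≠ 0 := by positivity
      simpa [p1, p2] using e
  ext m
  exact key _ m rfl

theorem IsHarmonicBasis.card_le [∀ l, Fintype (ι l)] (hY : IsHarmonicBasis Y) (l : ℕ) :
    Fintype.card (ι l) ≤ 2 * l + 1 := by
  choose P hP hP0 hPY using fun m => mem_sphHarm.1 (hY.mem l m)
  -- the exponents of degree `l` whose last entry is `0` (there are `l + 1`) or `1` (there are `l`)
  let e : Fin (l + 1) ⊕ Fin l → (Fin 3 →₀ ℕ) := Sum.elim
    (fun a => Finsupp.equivFunOnFinite.symm ![a, l - a, 0])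
    (fun a => Finsupp.equivFunOnFinite.symm ![a, l - 1 - a, 1])
  let T : MvPolynomial (Fin 3) ℝ →ₗ[ℝ] (Fin (l + 1) ⊕ Fin l → ℝ) :=
    LinearMap.pi fun s => lcoeff ℝ (e s)
  have hT (Q : MvPolynomial (Fin 3) ℝ) (hQ : Q.IsHomogeneous l)
      (hQ0 : ∑ i, pderiv i (pderiv i Q) = 0) (h : T Q = 0) : Q = 0 := by
    refine eq_zero_of_coeff_eq_zero hQ0 fun m hm => ?_
    by_contra hne
    have hd := hQ hne
    simp only [Finsupp.weight_apply, Pi.one_apply, smul_eq_mul, mul_one] at hd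
    rw [Finsupp.sum_fintype _ _ (by simp), Fin.sum_univ_three] at hd
    obtain ⟨s, hs⟩ : ∃ s, e s = m := by
      rcases Nat.le_one_iff_eq_zero_or_eq_one.1 hm with h | h
      · refine ⟨.inl ⟨m 0, by omega⟩, ?_⟩
        ext k
        fin_cases k <;> simp [e] <;> omega
      · refine ⟨.inr ⟨m 0, by omega⟩, ?_⟩
        ext k
        fin_cases k <;> simp [e] <;> omega
    exact hne (hs ▸ congrFun h s)
  have li : LinearIndependent ℝ (fun m => T (P m)) := by
    rw [Fintype.linearIndependent_iff]
    intro g hg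
    have hz : ∑ m, g m • P m = 0 := by
      refine hT _ (IsHomogeneous.sum _ _ _ fun m _ =>
        (homogeneousSubmodule (Fin 3) ℝ l).smul_mem _ (hP m)) ?_ (by simpa using hg)
      simp only [map_sum]
      rw [Finset.sum_comm]
      simp [← Finset.smul_sum, hP0]
    have := (Fintype.linearIndependent_iff.1 (hY.orthonormal l).linearIndependent) g
    refine this ?_
    have hs : toL2 (∑ m, g m • Y l m) = ∑ m, g m • toL2 (Y l m) := by
      simp [toL2]
    rw [← hs]
    have : ∑ m, g m • Y l m = 0 := by
      simp only [hPY, ← map_smul, ← map_sum, hz, map_zero]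
    rw [this, toL2, map_zero]
  have := li.fintype_card_le_finrank
  rw [Module.finrank_fintype_fun_eq_card] at this
  simp only [Fintype.card_sum, Fintype.card_fin] at this
  omega

/-! ### Rotation invariance -/

/-- The chain rule for a linear substitution. -/
theorem pderiv_aeval_linear (a : Fin 3 → Fin 3 → ℝ) (P : MvPolynomial (Fin 3) ℝ) (j : Fin 3) :
    pderiv j (aeval (fun i => ∑ j, C (a i j) * X j) P) =
      ∑ i, C (a i j) * aeval (fun i => ∑ j, C (a i j) * X j : Fin 3 → MvPolynomial (Fin 3) ℝ)
        (pderiv i P) := by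
  induction P using MvPolynomial.induction_on with
  | C r => simp
  | add p q hp hq => simp only [map_add, hp, hq, mul_add, Finset.sum_add_distrib]
  | mul_X p k hp =>
    simp only [map_mul, aeval_X, Derivation.leibniz, hp, smul_eq_mul, map_add, map_sum, mul_add,
      Finset.sum_add_distrib, pderiv_X, pderiv_C]
    congr 1
    · simp [Pi.single_apply, mul_comm]
    · rw [Finset.mul_sum]
      exact Finset.sum_congr rfl fun i _ => by ring

/-- The Laplacian commutes with orthogonal substitutions, so isometries preserve spherical
harmonics. -/
theorem comp_act_mem_sphHarm (R : EuclideanSpace ℝ (Fin 3) ≃ₗᵢ[ℝ] EuclideanSpace ℝ (Fin 3))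
    {l : ℕ} {f : C(S2, ℝ)} (hf : f ∈ sphHarm l) :
    f.comp ⟨act R, continuous_act R⟩ ∈ sphHarm l := by
  obtain ⟨P, hP, hP0, rfl⟩ := mem_sphHarm.1 hf
  -- the rows of the matrix of `R`
  let b : Fin 3 → EuclideanSpace ℝ (Fin 3) := fun i => R.symm (EuclideanSpace.single i 1)
  have hb (i k : Fin 3) : ∑ j, b i j * b k j = if i = k then 1 else 0 := by
    have : ⟪b i, b k⟫ = if i = k then 1 else 0 := by
      simp only [b, LinearIsometryEquiv.inner_map_map]
      rw [EuclideanSpace.inner_single_left]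
      simp
    rw [← this, PiLp.inner_apply]
    simp [mul_comm]
  have hR (x : EuclideanSpace ℝ (Fin 3)) (i : Fin 3) : R x i = ∑ j, b i j * x j := by
    have : R x i = ⟪b i, x⟫ := by
      rw [← R.inner_map_map]
      simp only [b, LinearIsometryEquiv.apply_symm_apply]
      rw [EuclideanSpace.inner_single_left]
      simp
    rw [this, PiLp.inner_apply]
    simp [mul_comm]
  refine mem_sphHarm.2 ⟨aeval (fun i => ∑ j, C (b i j) * X j) P, ?_, ?_, ?_⟩
  · have := hP.aeval (fun i => ∑ j, C (b i j) * X j : Fin 3 → MvPolynomial (Fin 3) ℝ) (n := 1)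
      fun i => IsHomogeneous.sum _ _ _ fun j _ => by
        simpa using (isHomogeneous_C (Fin 3) (b i j)).mul (isHomogeneous_X ℝ j)
    simpa using this
  · simp only [pderiv_aeval_linear (fun i j => b i j), map_sum, pderiv_C_mul, Finset.mul_sum]
    have (i k : Fin 3) : ∑ j, (C (b i j) * (C (b k j)) : MvPolynomial (Fin 3) ℝ) =
        if i = k then 1 else 0 := by
      rw [← C_1, ← C_0, ← apply_ite C, ← hb, map_sum]
      simp
    rw [Finset.sum_comm]
    simp only [← mul_assoc]
    calc _ = ∑ i, ∑ k, (∑ j, (C (b i j) * (C (b k j)) : MvPolynomial (Fin 3) ℝ)) *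
          aeval (fun i => ∑ j, C (b i j) * X j : Fin 3 → MvPolynomial (Fin 3) ℝ)
            (pderiv k (pderiv i P)) := by
          refine Finset.sum_congr rfl fun i _ => ?_
          rw [Finset.sum_comm]
          simp only [Finset.sum_mul]
      _ = aeval (fun i => ∑ j, C (b i j) * X j : Fin 3 → MvPolynomial (Fin 3) ℝ)
            (∑ i, pderiv i (pderiv i P)) := by
          simp [this]
      _ = 0 := by rw [hP0, map_zero]
  · ext x
    simp only [ContinuousMap.comp_apply, ContinuousMap.coe_mk, restr_apply, act, hR]
    clear hP hP0 hf
    induction P using MvPolynomial.induction_on with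
    | C a => simp
    | add p q hp hq => simp only [map_add, hp, hq]
    | mul_X p i hp => simp only [map_mul, hp, eval_X, aeval_X, map_sum, eval_C]

end Polynomials

section Fourier

variable {ι : ℕ → Type} {Y : ∀ l, ι l → C(S2, ℝ)}

/-! ### Spherical Fourier series in `L²` -/

theorem toL2_add (f g : C(S2, ℝ)) : toL2 (f + g) = toL2 f + toL2 g := map_add _ _ _

theorem toL2_smul (c : ℝ) (f : C(S2, ℝ)) : toL2 (c • f) = c • toL2 f := map_smul _ _ _

theorem toL2_sum {κ : Type*} (s : Finset κ) (f : κ → C(S2, ℝ)) :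
    toL2 (∑ i ∈ s, f i) = ∑ i ∈ s, toL2 (f i) := map_sum _ _ _

theorem toL2_injective : Function.Injective toL2 := ContinuousMap.toLp_injective surf

theorem inner_toL2 (f g : C(S2, ℝ)) : ⟪toL2 f, toL2 g⟫ = ∫ x, f x * g x ∂surf := by
  rw [toL2, toL2, ContinuousMap.inner_toLp]
  simp [mul_comm]

theorem inner_toL2_left (f : C(S2, ℝ)) (φ : L2) : ⟪toL2 f, φ⟫ = ∫ x, f x * φ x ∂surf := by
  rw [L2.inner_def]
  refine integral_congr_ae ?_
  filter_upwards [ContinuousMap.coeFn_toLp (p := 2) (𝕜 := ℝ) surf f] with x hx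
  rw [toL2, hx]
  simp [mul_comm]

theorem pointEval_toL2 (g : C(S2, ℝ)) (u : S2) : pointEval (toL2 g) u = g u := by
  have h : ∃ g' : C(S2, ℝ), toL2 g' = toL2 g := ⟨g, rfl⟩
  rw [pointEval, dif_pos h, toL2_injective h.choose_spec]

theorem coef_add (f g : L2) (l : ℕ) (m : ι l) :
    coef Y (f + g) l m = coef Y f l m + coef Y g l m := inner_add_left _ _ _

theorem coef_smul (c : ℝ) (f : L2) (l : ℕ) (m : ι l) :
    coef Y (c • f) l m = c * coef Y f l m := real_inner_smul_left _ _ _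

theorem coef_sum {κ : Type*} (s : Finset κ) (f : κ → L2) (l : ℕ) (m : ι l) :
    coef Y (∑ i ∈ s, f i) l m = ∑ i ∈ s, coef Y (f i) l m := sum_inner _ _ _

theorem IsHarmonicBasis.orthonormal_sigma (hY : IsHarmonicBasis Y) :
    Orthonormal ℝ fun s : Σ l, ι l => toL2 (Y s.1 s.2) := by
  refine ⟨fun s => (hY.orthonormal s.1).1 s.2, ?_⟩
  rintro ⟨l, m⟩ ⟨l', m'⟩ hne
  dsimp only
  rcases eq_or_ne l l' with rfl | hl
  · exact (hY.orthonormal l).2 fun h => hne (h ▸ rfl)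
  · rw [inner_toL2]
    exact integral_mul_eq_zero_of_mem_sphHarm hl (hY.mem l m) (hY.mem l' m')

theorem IsHarmonicBasis.dense_span (hY : IsHarmonicBasis Y) :
    ⊤ ≤ (Submodule.span ℝ (Set.range fun s : Σ l, ι l => toL2 (Y s.1 s.2))).topologicalClosure := by
  set S := Submodule.span ℝ (Set.range fun s : Σ l, ι l => toL2 (Y s.1 s.2))
  let T : C(S2, ℝ) →L[ℝ] L2 := ContinuousMap.toLp 2 surf ℝ
  have h1 : (⨆ l, sphHarm l) ≤ S.comap T.toLinearMap := by
    refine iSup_le fun l => ?_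
    rw [← hY.span_eq l, Submodule.span_le]
    rintro _ ⟨m, rfl⟩
    exact Submodule.subset_span ⟨⟨l, m⟩, rfl⟩
  have h2 (f : C(S2, ℝ)) : T f ∈ S.topologicalClosure := by
    have hf : f ∈ closure ((⨆ l, sphHarm l : Submodule ℝ C(S2, ℝ)) : Set C(S2, ℝ)) := by
      rw [← Submodule.topologicalClosure_coe, topologicalClosure_iSup_sphHarm]
      trivial
    exact map_mem_closure T.continuous hf fun g hg => h1 hg
  rintro f -
  have hd : DenseRange T := ContinuousMap.toLp_denseRange ℝ surf ℝ (by simp)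
  have := hd f
  refine closure_minimal ?_ S.isClosed_topologicalClosure this
  rintro _ ⟨g, rfl⟩
  exact h2 g

/-- The spherical harmonics of all degrees as a Hilbert basis of `L²`. -/
def IsHarmonicBasis.hilbertBasis (hY : IsHarmonicBasis Y) : HilbertBasis (Σ l, ι l) ℝ L2 :=
  HilbertBasis.mk hY.orthonormal_sigma hY.dense_span

theorem IsHarmonicBasis.hilbertBasis_apply (hY : IsHarmonicBasis Y) (s : Σ l, ι l) :
    hY.hilbertBasis s = toL2 (Y s.1 s.2) := by
  simp [IsHarmonicBasis.hilbertBasis]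

theorem IsHarmonicBasis.repr_apply (hY : IsHarmonicBasis Y) (f : L2) (s : Σ l, ι l) :
    hY.hilbertBasis.repr f s = coef Y f s.1 s.2 := by
  rw [HilbertBasis.repr_apply_apply, hY.hilbertBasis_apply, coef, real_inner_comm]

theorem IsHarmonicBasis.ext (hY : IsHarmonicBasis Y) {f g : L2}
    (h : ∀ l m, coef Y f l m = coef Y g l m) : f = g := by
  refine hY.hilbertBasis.repr.injective ?_
  ext s
  rw [hY.repr_apply, hY.repr_apply, h]

theorem IsHarmonicBasis.coef_toL2 (hY : IsHarmonicBasis Y) [DecidableEq (Σ l, ι l)]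
    (s t : Σ l, ι l) : coef Y (toL2 (Y s.1 s.2)) t.1 t.2 = if s = t then 1 else 0 :=
  orthonormal_iff_ite.1 hY.orthonormal_sigma s t

variable [∀ l, Fintype (ι l)]

theorem IsHarmonicBasis.hasSum_inner (hY : IsHarmonicBasis Y) (f g : L2) :
    HasSum (fun l => ∑ m, coef Y f l m * coef Y g l m) ⟪f, g⟫ := by
  have h := (hY.hilbertBasis.hasSum_inner_mul_inner f g).sigma fun l => hasSum_fintype _
  simpa only [hY.hilbertBasis_apply, real_inner_comm g, coef] using h

theorem IsHarmonicBasis.summable_coef_sq (hY : IsHarmonicBasis Y) (f : L2) :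
    Summable fun l => ∑ m, coef Y f l m ^ 2 := by
  simpa only [sq] using (hY.hasSum_inner f f).summable

/-- Square-summable coefficients are those of an `L²` function (Riesz-Fischer), whose series
converges when summed degree by degree. -/
theorem IsHarmonicBasis.exists_hasSum (hY : IsHarmonicBasis Y) {c : ∀ l, ι l → ℝ}
    (hc : Summable fun l => ∑ m, c l m ^ 2) :
    ∃ g : L2, HasSum (fun l => ∑ m, c l m • toL2 (Y l m)) g ∧ ∀ l m, coef Y g l m = c l m := by
  have hs : Summable fun s : Σ l, ι l => c s.1 s.2 ^ 2 := by
    rw [summable_sigma_of_nonneg fun _ => sq_nonneg _]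
    refine ⟨fun l => (hasSum_fintype _).summable, ?_⟩
    simpa only [tsum_fintype] using hc
  have hm : Memℓp (fun s : Σ l, ι l => c s.1 s.2) 2 := by
    rw [memℓp_gen_iff (by simp)]
    simpa using hs
  refine ⟨hY.hilbertBasis.repr.symm ⟨_, hm⟩, ?_, fun l m => ?_⟩
  · have := (hY.hilbertBasis.hasSum_repr_symm ⟨_, hm⟩).sigma fun l => hasSum_fintype _
    simpa only [hY.hilbertBasis_apply] using this
  · have := hY.repr_apply (hY.hilbertBasis.repr.symm ⟨_, hm⟩) ⟨l, m⟩
    rw [← this, LinearIsometryEquiv.apply_symm_apply]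

theorem IsHarmonicBasis.coef_op (hY : IsHarmonicBasis Y) {D : ℕ → ℝ} {f : L2}
    (h : Summable fun l => D l ^ 2 * ∑ m, coef Y f l m ^ 2) (l : ℕ) (m : ι l) :
    coef Y (op Y D f) l m = D l * coef Y f l m := by
  obtain ⟨g, hg, hgc⟩ := hY.exists_hasSum (c := fun l m => D l * coef Y f l m) (by
    simpa only [mul_pow, ← Finset.mul_sum] using h)
  have : op Y D f = g := by
    rw [op, ← hg.tsum_eq]
    simp only [Finset.smul_sum, smul_smul]
  rw [this, hgc]

/-! ### The reproducing kernels of the spaces of spherical harmonics -/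

/-- The reproducing kernel of the space of spherical harmonics of degree `l`. -/
def harmKernel (Y : ∀ l, ι l → C(S2, ℝ)) (l : ℕ) (u v : S2) : ℝ := ∑ m, Y l m u * Y l m v

theorem IsHarmonicBasis.eq_sum (hY : IsHarmonicBasis Y) {l : ℕ} {f : C(S2, ℝ)}
    (hf : f ∈ sphHarm l) : f = ∑ m, coef Y (toL2 f) l m • Y l m := by
  rw [← hY.span_eq, Submodule.mem_span_range_iff_exists_fun] at hf
  obtain ⟨c, rfl⟩ := hf
  refine Finset.sum_congr rfl fun m _ => ?_
  congr 1
  rw [toL2_sum]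
  simp only [toL2_smul]
  exact ((hY.orthonormal l).inner_left_fintype c m).symm

/-- The reproducing kernel is invariant under isometries of the sphere. -/
theorem IsHarmonicBasis.harmKernel_act (hY : IsHarmonicBasis Y)
    (R : EuclideanSpace ℝ (Fin 3) ≃ₗᵢ[ℝ] EuclideanSpace ℝ (Fin 3)) (l : ℕ) (u v : S2) :
    harmKernel Y l (act R u) (act R v) = harmKernel Y l u v := by
  classical
  let Z (m : ι l) : C(S2, ℝ) := (Y l m).comp ⟨act R, continuous_act R⟩
  let A : Matrix (ι l) (ι l) ℝ := Matrix.of fun m k => coef Y (toL2 (Z m)) l k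
  have hZ (m : ι l) : Z m = ∑ k, A m k • Y l k :=
    hY.eq_sum (comp_act_mem_sphHarm R (hY.mem l m))
  have hZx (m : ι l) (x : S2) : Y l m (act R x) = ∑ k, A m k * Y l k x := by
    have := congrArg (fun f : C(S2, ℝ) => f x) (hZ m)
    simpa [Z] using this
  -- composition with `R` maps the orthonormal basis to another one
  have hA : A * A.transpose = 1 := by
    ext m k
    have h1 : ⟪toL2 (Z m), toL2 (Z k)⟫ = if m = k then 1 else 0 := by
      rw [← orthonormal_iff_ite.1 (hY.orthonormal l) m k, inner_toL2, inner_toL2]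
      exact integral_comp_act R (Y l m * Y l k)
    have h2 : toL2 (Z k) = ∑ j, A k j • toL2 (Y l j) := by
      conv_lhs => rw [hZ k, toL2_sum]
      simp only [toL2_smul]
    rw [h2, inner_sum] at h1
    simp only [real_inner_smul_right] at h1
    rw [Matrix.mul_apply, Matrix.one_apply, ← h1]
    exact Finset.sum_congr rfl fun j _ => mul_comm _ _
  have hA' : A.transpose * A = 1 := mul_eq_one_comm.1 hA
  have hA'' (j k : ι l) : ∑ m, A m j * A m k = if j = k then 1 else 0 := by
    have := congrFun (congrFun hA' j) k
    rwa [Matrix.mul_apply, Matrix.one_apply] at this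
  calc harmKernel Y l (act R u) (act R v)
      = ∑ m, ∑ j, ∑ k, (A m j * A m k) * (Y l j u * Y l k v) := by
        refine Finset.sum_congr rfl fun m _ => ?_
        rw [hZx, hZx, Finset.sum_mul_sum]
        exact Finset.sum_congr rfl fun j _ => Finset.sum_congr rfl fun k _ => by ring
    _ = ∑ j, ∑ k, (∑ m, A m j * A m k) * (Y l j u * Y l k v) := by
        rw [Finset.sum_comm]
        refine Finset.sum_congr rfl fun j _ => ?_
        rw [Finset.sum_comm]
        simp only [Finset.sum_mul]
    _ = harmKernel Y l u v := by simp [hA'', harmKernel]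

/-- Two pairs of points of the sphere with the same inner product are congruent. -/
theorem exists_act_eq {u v u' v' : S2} (h : dot u v = dot u' v') :
    ∃ R : EuclideanSpace ℝ (Fin 3) ≃ₗᵢ[ℝ] EuclideanSpace ℝ (Fin 3),
      act R u = u' ∧ act R v = v' := by
  have hin : ⟪(u : EuclideanSpace ℝ (Fin 3)), (v : EuclideanSpace ℝ (Fin 3))⟫ =
      ⟪(u' : EuclideanSpace ℝ (Fin 3)), (v' : EuclideanSpace ℝ (Fin 3))⟫ :=
    congrArg Subtype.val h
  have n (x : S2) : ‖(x : EuclideanSpace ℝ (Fin 3))‖ = 1 := norm_eq_of_mem_sphere x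
  -- the first reflection moves `u` to `u'`, the second one fixes `u'`
  let R₁ := (ℝ ∙ ((u : EuclideanSpace ℝ (Fin 3)) - u'))ᗮ.reflection
  have h1 : R₁ u = u' := Submodule.reflection_sub (by rw [n, n])
  let R₂ := (ℝ ∙ (R₁ v - (v' : EuclideanSpace ℝ (Fin 3))))ᗮ.reflection
  have h2 : R₂ (R₁ v) = v' := Submodule.reflection_sub (by rw [R₁.norm_map, n, n])
  have h3 : R₂ u' = u' := by
    refine Submodule.reflection_mem_subspace_eq_self ?_
    rw [Submodule.mem_orthogonal_singleton_iff_inner_right, inner_sub_left, ← h1,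
      R₁.inner_map_map, h1, real_inner_comm, hin, real_inner_comm, sub_self]
  exact ⟨R₁.trans R₂, Subtype.ext (by simp [act, h1, h3]), Subtype.ext (by simp [act, h2])⟩

theorem dot_comm (u v : S2) : dot u v = dot v u := Subtype.ext (real_inner_comm _ _)

theorem measureReal_surf_pos : 0 < surf.real Set.univ := by
  rw [measureReal_def, ENNReal.toReal_pos_iff]
  exact ⟨Measure.measure_univ_pos.2 (Measure.toSphere_ne_zero _), measure_lt_top _ _⟩

/-- The diagonal of the reproducing kernel is constant, hence equal to the dimension of the space
divided by the area of the sphere. -/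
theorem IsHarmonicBasis.harmKernel_self_le (hY : IsHarmonicBasis Y) (l : ℕ) (u : S2) :
    harmKernel Y l u u ≤ (2 * l + 1) / surf.real Set.univ := by
  have hc (v : S2) : harmKernel Y l v v = harmKernel Y l u u := by
    obtain ⟨R, h1, -⟩ := exists_act_eq (u := u) (v := u) (u' := v) (v' := v)
      (Subtype.ext (by simp [dot, norm_eq_of_mem_sphere]))
    rw [← h1, hY.harmKernel_act]
  have hI : ∫ v, harmKernel Y l v v ∂surf = Fintype.card (ι l) := by
    simp only [harmKernel]
    have hi (m : ι l) : Integrable (fun v => Y l m v * Y l m v) surf :=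
      integrable_continuousMap (Y l m * Y l m)
    rw [integral_finsetSum _ fun m _ => hi m]
    have (m : ι l) : ∫ v, Y l m v * Y l m v ∂surf = 1 := by
      rw [← inner_toL2, real_inner_self_eq_norm_sq, (hY.orthonormal l).1 m, one_pow]
    simp [this]
  simp only [hc, integral_const, smul_eq_mul] at hI
  rw [le_div_iff₀ measureReal_surf_pos, mul_comm, hI]
  exact_mod_cast hY.card_le l

end Fourier

section Sobolev

variable {ι : ℕ → Type} {Y : ∀ l, ι l → C(S2, ℝ)} [∀ l, Fintype (ι l)]

/-! ### Sobolev spaces and point evaluation -/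

/-- The weight `(1 + l(l+1))^p` of the Sobolev space of order `p`. -/
def weight (p : ℝ) (l : ℕ) : ℝ := (1 + (l : ℝ) * (l + 1)) ^ p

theorem weight_pos (p : ℝ) (l : ℕ) : 0 < weight p l := Real.rpow_pos_of_pos (by positivity) _

theorem one_le_weight {p : ℝ} (hp : 0 ≤ p) (l : ℕ) : 1 ≤ weight p l :=
  Real.one_le_rpow (le_add_of_nonneg_right (by positivity)) hp

theorem weight_le {p : ℝ} (hp : 0 ≤ p) (l : ℕ) : weight p l ≤ ((1 + (l : ℝ)) ^ p) ^ 2 := by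
  rw [weight, Real.rpow_pow_comm (by positivity)]
  refine Real.rpow_le_rpow (by positivity) ?_ hp
  nlinarith [(Nat.cast_nonneg l : (0 : ℝ) ≤ l)]

theorem le_weight {p : ℝ} (hp : 0 ≤ p) (l : ℕ) :
    ((1 + (l : ℝ)) ^ p) ^ 2 ≤ 2 ^ p * weight p l := by
  rw [weight, Real.rpow_pow_comm (by positivity), ← Real.mul_rpow (by positivity) (by positivity)]
  refine Real.rpow_le_rpow (by positivity) ?_ hp
  nlinarith [(Nat.cast_nonneg l : (0 : ℝ) ≤ l)]

/-- The dimension `2l+1` of the spaces of harmonics is summable against the inverse Sobolev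
weight. This is where the order has to exceed `1`. -/
theorem summable_div_weight {p : ℝ} (hp : 1 < p) :
    Summable fun l : ℕ => (2 * (l : ℝ) + 1) / weight p l := by
  have h : Summable fun l : ℕ => 2 * 2 ^ p * ((l + 1 : ℕ) : ℝ) ^ (1 - 2 * p) :=
    ((summable_nat_add_iff 1).2 (Real.summable_nat_rpow.2 (by linarith))).mul_left _
  refine h.of_nonneg_of_le (fun l => ?_) fun l => ?_
  · exact div_nonneg (by positivity) (weight_pos p l).le
  · rw [div_le_iff₀ (weight_pos p l)]
    have hl : (0 : ℝ) < 1 + l := by positivity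
    have e : ((l + 1 : ℕ) : ℝ) ^ (1 - 2 * p) * ((1 + (l : ℝ)) ^ p) ^ 2 = 1 + l := by
      push_cast
      rw [add_comm (l : ℝ) 1, ← Real.rpow_natCast, ← Real.rpow_mul hl.le, ← Real.rpow_add hl]
      norm_num
      ring_nf
      simp
    have hx : 0 < ((l + 1 : ℕ) : ℝ) ^ (1 - 2 * p) := by positivity
    have := mul_le_mul_of_nonneg_left (le_weight (by linarith : 0 ≤ p) l) hx.le
    rw [e] at this
    nlinarith

theorem mem_sobolev {p : ℝ} {f : L2} :
    f ∈ sobolev Y p ↔ Summable fun l => weight p l * ∑ m, coef Y f l m ^ 2 := Iff.rfl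

theorem add_mem_sobolev {p : ℝ} {f g : L2} (hf : f ∈ sobolev Y p) (hg : g ∈ sobolev Y p) :
    f + g ∈ sobolev Y p := by
  rw [mem_sobolev] at *
  refine ((hf.add hg).mul_left 2).of_nonneg_of_le (fun l => ?_) fun l => ?_
  · exact mul_nonneg (weight_pos p l).le (Finset.sum_nonneg fun _ _ => sq_nonneg _)
  · rw [← mul_add, ← Finset.sum_add_distrib, mul_left_comm 2]
    refine mul_le_mul_of_nonneg_left ?_ (weight_pos p l).le
    rw [Finset.mul_sum]
    refine Finset.sum_le_sum fun m _ => ?_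
    rw [coef_add]
    nlinarith [sq_nonneg (coef Y f l m - coef Y g l m)]

theorem smul_mem_sobolev {p : ℝ} (c : ℝ) {f : L2} (hf : f ∈ sobolev Y p) :
    c • f ∈ sobolev Y p := by
  rw [mem_sobolev] at *
  refine (hf.mul_left (c ^ 2)).congr fun l => ?_
  simp only [coef_smul, mul_pow, ← Finset.mul_sum]
  ring

theorem sum_smul_mem_sobolev {κ : Type*} {p : ℝ} (s : Finset κ) (c : κ → ℝ) {f : κ → L2}
    (hf : ∀ i, f i ∈ sobolev Y p) : ∑ i ∈ s, c i • f i ∈ sobolev Y p := by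
  classical
  induction s using Finset.induction_on with
  | empty =>
    have := smul_mem_sobolev (Y := Y) (p := p) 0 (f := 0)
      (by simp [mem_sobolev, coef])
    simpa using this
  | insert a s ha ih =>
    rw [Finset.sum_insert ha]
    exact add_mem_sobolev (smul_mem_sobolev _ (hf a)) ih

theorem sq_sum_mul_harmonic_le (hY : IsHarmonicBasis Y) (l : ℕ) (c : ι l → ℝ) (u : S2) :
    (∑ m, c m * Y l m u) ^ 2 ≤ (∑ m, c m ^ 2) * ((2 * l + 1) / surf.real Set.univ) := by
  refine (Finset.sum_mul_sq_le_sq_mul_sq _ _ _).trans ?_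
  refine mul_le_mul_of_nonneg_left ?_ (Finset.sum_nonneg fun _ _ => sq_nonneg _)
  simpa only [harmKernel, sq] using hY.harmKernel_self_le l u

/-- A series of spherical harmonics whose coefficients satisfy the Sobolev condition of order
`p > 1` converges uniformly, by the Cauchy-Schwarz inequality and the addition theorem. -/
theorem summable_harmonics (hY : IsHarmonicBasis Y) {p : ℝ} (hp : 1 < p) {c : ∀ l, ι l → ℝ}
    (hc : Summable fun l => weight p l * ∑ m, c l m ^ 2) :
    Summable fun l => ∑ m, c l m • Y l m := by
  refine Summable.of_norm_bounded
    (hc.add ((summable_div_weight hp).mul_right (surf.real Set.univ)⁻¹)) fun l => ?_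
  have hw := weight_pos p l
  have hA := measureReal_surf_pos
  have hs : 0 ≤ ∑ m, c l m ^ 2 := Finset.sum_nonneg fun _ _ => sq_nonneg _
  have h0 : 0 ≤ weight p l * ∑ m, c l m ^ 2 := by positivity
  have h1 : 0 ≤ (2 * (l : ℝ) + 1) / weight p l * (surf.real Set.univ)⁻¹ := by positivity
  rw [ContinuousMap.norm_le _ (by positivity)]
  intro x
  rw [Real.norm_eq_abs]
  refine abs_le_of_sq_le_sq ?_ (by positivity)
  have e : (∑ m, c l m • Y l m) x = ∑ m, c l m * Y l m x := by simp
  rw [e]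
  refine (sq_sum_mul_harmonic_le hY l (c l) x).trans ?_
  have e2 : (∑ m, c l m ^ 2) * ((2 * l + 1) / surf.real Set.univ) =
      (weight p l * ∑ m, c l m ^ 2) *
        ((2 * (l : ℝ) + 1) / weight p l * (surf.real Set.univ)⁻¹) := by
    field_simp
  -- the product of two nonnegative numbers is at most the square of their sum
  rw [e2]
  nlinarith [mul_nonneg h0 h1]

/-- Coefficients satisfying the Sobolev condition of order `p > 1` are those of a continuous
function, the pointwise sum of its spherical Fourier series. -/
theorem exists_continuousMap (hY : IsHarmonicBasis Y) {p : ℝ} (hp : 1 < p) {c : ∀ l, ι l → ℝ}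
    (hc : Summable fun l => weight p l * ∑ m, c l m ^ 2) :
    ∃ g : C(S2, ℝ), (∀ l m, coef Y (toL2 g) l m = c l m) ∧
      ∀ u, HasSum (fun l => ∑ m, c l m * Y l m u) (g u) := by
  obtain ⟨g, hg⟩ := summable_harmonics hY hp hc
  have hc' : Summable fun l => ∑ m, c l m ^ 2 :=
    hc.of_nonneg_of_le (fun l => Finset.sum_nonneg fun _ _ => sq_nonneg _) fun l =>
      le_mul_of_one_le_left (Finset.sum_nonneg fun _ _ => sq_nonneg _)
        (one_le_weight (by linarith) l)
  obtain ⟨f, hf, hfc⟩ := hY.exists_hasSum hc'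
  have hT : HasSum (fun l => ∑ m, c l m • toL2 (Y l m)) (toL2 g) := by
    have := hg.mapL (ContinuousMap.toLp (E := ℝ) 2 surf ℝ)
    simpa [toL2] using this
  refine ⟨g, fun l m => ?_, fun u => ?_⟩
  · rw [hT.unique hf, hfc]
  · have := hg.mapL (ContinuousMap.evalCLM ℝ u)
    simpa using this

theorem exists_representative (hY : IsHarmonicBasis Y) {p : ℝ} (hp : 1 < p) {f : L2}
    (hf : f ∈ sobolev Y p) : ∃ g : C(S2, ℝ), toL2 g = f := by
  obtain ⟨g, hg, -⟩ := exists_continuousMap hY hp (mem_sobolev.1 hf)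
  exact ⟨g, hY.ext hg⟩

theorem hasSum_pointEval (hY : IsHarmonicBasis Y) {p : ℝ} (hp : 1 < p) {f : L2}
    (hf : f ∈ sobolev Y p) (u : S2) :
    HasSum (fun l => ∑ m, coef Y f l m * Y l m u) (pointEval f u) := by
  obtain ⟨g, hg, hs⟩ := exists_continuousMap hY hp (mem_sobolev.1 hf)
  rw [← hY.ext hg, pointEval_toL2, hY.ext hg]
  exact hs u

theorem pointEval_add (hY : IsHarmonicBasis Y) {p : ℝ} (hp : 1 < p) {f g : L2}
    (hf : f ∈ sobolev Y p) (hg : g ∈ sobolev Y p) (u : S2) :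
    pointEval (f + g) u = pointEval f u + pointEval g u := by
  obtain ⟨f, rfl⟩ := exists_representative hY hp hf
  obtain ⟨g, rfl⟩ := exists_representative hY hp hg
  simp only [← toL2_add, pointEval_toL2, ContinuousMap.add_apply]

theorem toL2_mem_smooth (hY : IsHarmonicBasis Y) (l : ℕ) (m : ι l) : toL2 (Y l m) ∈ smooth Y := by
  classical
  refine Set.mem_iInter.2 fun q => ?_
  rw [mem_sobolev]
  refine summable_of_ne_finset_zero (s := {l}) fun k hk => ?_
  rw [Finset.sum_eq_zero, mul_zero]
  intro j _
  rw [hY.coef_toL2 ⟨l, m⟩ ⟨k, j⟩, if_neg, sq, zero_mul]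
  intro h
  exact hk (Finset.mem_singleton.2 (congrArg Sigma.fst h).symm)

/-! ### Admissible operators -/

variable {D : ℕ → ℝ} {p : ℝ}

theorem IsAdmissible.exists_bounds (hD : IsAdmissible D p) :
    ∃ c C : ℝ, 0 < c ∧ 0 < C ∧ ∀ l, c * weight p l ≤ D l ^ 2 ∧ D l ^ 2 ≤ C * weight p l := by
  obtain ⟨hp, -, C₁, C₂, h1, h2, h⟩ := hD
  refine ⟨C₁ ^ 2, C₂ ^ 2 * 2 ^ p, by positivity, by positivity, fun l => ⟨?_, ?_⟩⟩
  · calc C₁ ^ 2 * weight p l ≤ C₁ ^ 2 * ((1 + (l : ℝ)) ^ p) ^ 2 := by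
          gcongr; exact weight_le hp l
      _ = (C₁ * (1 + (l : ℝ)) ^ p) ^ 2 := by ring
      _ ≤ |D l| ^ 2 := by gcongr; exact (h l).1
      _ = D l ^ 2 := sq_abs _
  · calc D l ^ 2 = |D l| ^ 2 := (sq_abs _).symm
      _ ≤ (C₂ * (1 + (l : ℝ)) ^ p) ^ 2 := by gcongr; exact (h l).2
      _ = C₂ ^ 2 * ((1 + (l : ℝ)) ^ p) ^ 2 := by ring
      _ ≤ C₂ ^ 2 * (2 ^ p * weight p l) := by gcongr; exact le_weight hp l
      _ = C₂ ^ 2 * 2 ^ p * weight p l := by ring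

theorem adjMul_eq (D : ℕ → ℝ) (l : ℕ) : adjMul D l = D l ^ 2 := by
  simp [adjMul, sq]

theorem coef_op_of_mem (hY : IsHarmonicBasis Y) (hD : IsAdmissible D p) {f : L2}
    (hf : f ∈ sobolev Y p) (l : ℕ) (m : ι l) : coef Y (op Y D f) l m = D l * coef Y f l m := by
  obtain ⟨c, C, hc, hC, h⟩ := hD.exists_bounds
  refine hY.coef_op ?_ l m
  refine ((mem_sobolev.1 hf).mul_left C).of_nonneg_of_le (fun l => by positivity) fun l => ?_
  rw [← mul_assoc]
  exact mul_le_mul_of_nonneg_right (h l).2 (Finset.sum_nonneg fun _ _ => sq_nonneg _)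

theorem op_add (hY : IsHarmonicBasis Y) (hD : IsAdmissible D p) {f g : L2}
    (hf : f ∈ sobolev Y p) (hg : g ∈ sobolev Y p) : op Y D (f + g) = op Y D f + op Y D g := by
  refine hY.ext fun l m => ?_
  rw [coef_add, coef_op_of_mem hY hD hf, coef_op_of_mem hY hD hg,
    coef_op_of_mem hY hD (add_mem_sobolev hf hg), coef_add, mul_add]

theorem eq_zero_of_op_eq_zero (hY : IsHarmonicBasis Y) (hD : IsAdmissible D p) {f : L2}
    (hf : f ∈ sobolev Y p) (h : op Y D f = 0) : f = 0 := by
  refine hY.ext fun l m => ?_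
  have := coef_op_of_mem hY hD hf l m
  rw [h] at this
  simpa [coef, hD.2.1 l] using this

theorem inv_sq_le (hD : IsAdmissible D p) :
    ∃ C : ℝ, 0 < C ∧ ∀ l, weight p l * (D l ^ 2)⁻¹ ≤ C := by
  obtain ⟨c, C, hc, -, h⟩ := hD.exists_bounds
  refine ⟨c⁻¹, by positivity, fun l => ?_⟩
  have hw := weight_pos p l
  calc weight p l * (D l ^ 2)⁻¹ ≤ weight p l * (c * weight p l)⁻¹ := by
        gcongr; exact (h l).1
    _ = c⁻¹ := by field_simp

/-! ### The zonal Green's kernel -/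

/-- The coefficients of the Green's functions satisfy the Sobolev condition. -/
theorem summable_weight_mul_green (hY : IsHarmonicBasis Y) (hD : IsAdmissible D p) (hp : 1 < p)
    (u : S2) : Summable fun l => weight p l * ∑ m, ((D l ^ 2)⁻¹ * Y l m u) ^ 2 := by
  obtain ⟨C, hC, h⟩ := inv_sq_le hD
  refine (((summable_div_weight hp).mul_right (surf.real Set.univ)⁻¹).mul_left
    (C ^ 2)).of_nonneg_of_le (fun l => ?_) fun l => ?_
  · exact mul_nonneg (weight_pos p l).le (Finset.sum_nonneg fun _ _ => sq_nonneg _)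
  · have hw := weight_pos p l
    have hA := measureReal_surf_pos
    have hk := hY.harmKernel_self_le l u
    have hk0 : 0 ≤ harmKernel Y l u u := Finset.sum_nonneg fun m _ => mul_self_nonneg _
    have e : ∑ m, ((D l ^ 2)⁻¹ * Y l m u) ^ 2 = ((D l ^ 2)⁻¹) ^ 2 * harmKernel Y l u u := by
      simp only [mul_pow, ← Finset.mul_sum, harmKernel, sq (Y _ _ _)]
    have h0 : 0 ≤ weight p l * (D l ^ 2)⁻¹ := by positivity
    calc _ = (weight p l * (D l ^ 2)⁻¹) ^ 2 * (harmKernel Y l u u / weight p l) := by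
          rw [e]; field_simp
      _ ≤ C ^ 2 * ((2 * l + 1) / surf.real Set.univ / weight p l) := by
          gcongr
          exact h l
      _ = _ := by field_simp

/-- The Green's function centred at `u` as a continuous function, together with its spherical
Fourier series. -/
theorem exists_green (hY : IsHarmonicBasis Y) (hD : IsAdmissible D p) (hp : 1 < p) (u : S2) :
    ∃ g : C(S2, ℝ), (∀ l m, coef Y (toL2 g) l m = (D l ^ 2)⁻¹ * Y l m u) ∧
      ∀ v, HasSum (fun l => (D l ^ 2)⁻¹ * harmKernel Y l u v) (g v) := by
  obtain ⟨g, hg, hs⟩ := exists_continuousMap hY hp (summable_weight_mul_green hY hD hp u)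
  refine ⟨g, hg, fun v => ?_⟩
  simpa only [harmKernel, Finset.mul_sum, mul_assoc] using hs v

/-- A continuous function on `[-1, 1]` is the zonal Green's kernel of `𝒟* 𝒟` exactly when the
spherical Fourier coefficients of its zonal functions are those of `(𝒟* 𝒟)⁻¹ δ_u`. -/
theorem isZonalGreenKernel_iff (hY : IsHarmonicBasis Y) (hD : IsAdmissible D p) (hp : 1 < p)
    (ψ : C(Set.Icc (-1 : ℝ) 1, ℝ)) : IsZonalGreenKernel Y (adjMul D) ψ ↔
      ∀ u l m, coef Y (toL2 (zonal ψ u)) l m = (D l ^ 2)⁻¹ * Y l m u := by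
  classical
  -- the point values of `(𝒟* 𝒟)⁻¹ φ` for smooth `φ`
  have key {φ : L2} (hφ : φ ∈ smooth Y) (u : S2) :
      HasSum (fun l => ∑ m, (D l ^ 2)⁻¹ * coef Y φ l m * Y l m u)
        (greenDist Y (adjMul D) u φ) := by
    obtain ⟨C, hC, h⟩ := inv_sq_le hD
    have hφp : φ ∈ sobolev Y p := Set.mem_iInter.1 hφ ⟨p, hD.1⟩
    have hb (l : ℕ) : (D l ^ 2)⁻¹ ≤ C :=
      (le_mul_of_one_le_left (by positivity) (one_le_weight hD.1 l)).trans (h l)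
    have hco (l : ℕ) (m : ι l) : coef Y (op Y (fun l => (adjMul D l)⁻¹) φ) l m =
        (D l ^ 2)⁻¹ * coef Y φ l m := by
      simp only [adjMul_eq]
      refine hY.coef_op ?_ l m
      refine ((hY.summable_coef_sq φ).mul_left (C ^ 2)).of_nonneg_of_le
        (fun l => by positivity) fun l => ?_
      gcongr
      exact hb l
    have hmem : op Y (fun l => (adjMul D l)⁻¹) φ ∈ sobolev Y p := by
      rw [mem_sobolev]
      simp only [hco, mul_pow, ← Finset.mul_sum]
      refine ((mem_sobolev.1 hφp).mul_left (C ^ 2)).of_nonneg_of_le (fun l => ?_) fun l => ?_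
      · have := weight_pos p l
        positivity
      · have := weight_pos p l
        rw [mul_left_comm]
        gcongr
        exact hb l
    have := hasSum_pointEval hY hp hmem u
    simp only [hco] at this
    exact this
  constructor
  · intro hψ u l m
    have h1 := hψ u _ (toL2_mem_smooth hY l m)
    rw [← inner_toL2_left] at h1
    rw [coef, h1]
    refine (key (toL2_mem_smooth hY l m) u).unique ?_
    have e := hasSum_single (f := fun k => ∑ j, (D k ^ 2)⁻¹ * coef Y (toL2 (Y l m)) k j * Y k j u)
      l fun k hk => Finset.sum_eq_zero fun j _ => by
        rw [hY.coef_toL2 ⟨l, m⟩ ⟨k, j⟩, if_neg, mul_zero, zero_mul]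
        intro h
        exact hk (congrArg Sigma.fst h).symm
    convert! e using 1
    have (j : ι l) : coef Y (toL2 (Y l m)) l j = if m = j then 1 else 0 :=
      orthonormal_iff_ite.1 (hY.orthonormal l) m j
    simp [this]
  · intro h u φ hφ
    rw [← inner_toL2_left]
    refine (hY.hasSum_inner _ _).unique ?_
    have e : (fun l => ∑ m, coef Y (toL2 (zonal ψ u)) l m * coef Y φ l m) =
        fun l => ∑ m, (D l ^ 2)⁻¹ * coef Y φ l m * Y l m u := by
      funext l
      exact Finset.sum_congr rfl fun m _ => by rw [h]; ring
    rw [e]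
    exact key hφ u

/-- The point of the sphere on the great circle through the first two coordinate vectors whose
inner product with the first one is `t`. -/
def meridian (t : Set.Icc (-1 : ℝ) 1) : S2 :=
  ⟨!₂[(t : ℝ), √(1 - t ^ 2), 0], by
    have : 0 ≤ 1 - (t : ℝ) ^ 2 := by nlinarith [t.2.1, t.2.2]
    simp [EuclideanSpace.norm_eq, Fin.sum_univ_three, Real.sq_sqrt this]⟩

theorem continuous_meridian : Continuous meridian := by
  refine Continuous.subtype_mk ?_ _
  refine (PiLp.continuous_toLp 2 _).comp (continuous_pi fun i => ?_)
  fin_cases i <;> simp <;> fun_prop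

theorem dot_meridian_one (t : Set.Icc (-1 : ℝ) 1) :
    dot (meridian ⟨1, by simp⟩) (meridian t) = t := by
  ext1
  simp [dot, meridian, PiLp.inner_apply, Fin.sum_univ_three]

theorem existsUnique_isZonalGreenKernel (hY : IsHarmonicBasis Y) (hD : IsAdmissible D p)
    (hp : 1 < p) : ∃! ψ : C(Set.Icc (-1 : ℝ) 1, ℝ), IsZonalGreenKernel Y (adjMul D) ψ := by
  choose g hg hs using exists_green hY hD hp
  have hinv {u v u' v' : S2} (h : dot u v = dot u' v') : g u v = g u' v' := by
    obtain ⟨R, rfl, rfl⟩ := exists_act_eq h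
    refine (hs u v).unique ?_
    simpa only [hY.harmKernel_act] using hs (act R u) (act R v)
  set e : S2 := meridian ⟨1, by simp⟩ with he
  refine ⟨(g e).comp ⟨meridian, continuous_meridian⟩, ?_, ?_⟩
  · refine (isZonalGreenKernel_iff hY hD hp _).2 fun u l m => ?_
    rw [← hg]
    congr 2
    ext v
    refine hinv ?_
    rw [he, ContinuousMap.coe_mk, dot_meridian_one, dot_comm]
  · intro ψ hψ
    have h1 : zonal ψ e = g e := toL2_injective <| hY.ext fun l m => by
      rw [(isZonalGreenKernel_iff hY hD hp _).1 hψ, hg]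
    ext t
    rw [ContinuousMap.comp_apply, ← h1]
    change ψ t = ψ (dot (meridian t) e)
    rw [dot_comm, he, dot_meridian_one]

end Sobolev

section Splines

variable {ι : ℕ → Type} {Y : ∀ l, ι l → C(S2, ℝ)} [∀ l, Fintype (ι l)] {D : ℕ → ℝ} {p : ℝ}
  {ψ : C(Set.Icc (-1 : ℝ) 1, ℝ)} {n : ℕ} {r : Fin n → ℕ} {u : ∀ i, Fin (r i) → S2}

/-! ### Splines -/

theorem zonal_mem_sobolev (hY : IsHarmonicBasis Y) (hD : IsAdmissible D p) (hp : 1 < p)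
    (hψ : IsZonalGreenKernel Y (adjMul D) ψ) (v : S2) : toL2 (zonal ψ v) ∈ sobolev Y p := by
  rw [mem_sobolev]
  simp only [(isZonalGreenKernel_iff hY hD hp ψ).1 hψ v]
  exact summable_weight_mul_green hY hD hp v

theorem spline_apply (α : (Σ i, Fin (r i)) → ℝ) (v : S2) :
    spline ψ u α v = ∑ a, α a / √(r a.1 : ℝ) * ψ (dot v (u a.1 a.2)) := by
  rw [Fintype.sum_sigma]
  simp only [spline, ContinuousMap.sum_apply, ContinuousMap.smul_apply, smul_eq_mul,
    Finset.mul_sum]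
  refine Finset.sum_congr rfl fun i _ => Finset.sum_congr rfl fun j _ => ?_
  change _ * (_ * ψ (dot v (u i j))) = _
  ring

theorem toL2_spline (α : (Σ i, Fin (r i)) → ℝ) :
    toL2 (spline ψ u α) = ∑ a, (α a / √(r a.1 : ℝ)) • toL2 (zonal ψ (u a.1 a.2)) := by
  simp only [← toL2_smul, ← toL2_sum]
  congr 1
  ext v
  rw [spline_apply]
  simp only [ContinuousMap.sum_apply, ContinuousMap.smul_apply, smul_eq_mul]
  rfl

theorem spline_mem_sobolev (hY : IsHarmonicBasis Y) (hD : IsAdmissible D p) (hp : 1 < p)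
    (hψ : IsZonalGreenKernel Y (adjMul D) ψ) (α : (Σ i, Fin (r i)) → ℝ) :
    toL2 (spline ψ u α) ∈ sobolev Y p := by
  rw [toL2_spline]
  exact sum_smul_mem_sobolev _ _ fun a => zonal_mem_sobolev hY hD hp hψ _

theorem coef_spline (hY : IsHarmonicBasis Y) (hD : IsAdmissible D p) (hp : 1 < p)
    (hψ : IsZonalGreenKernel Y (adjMul D) ψ) (α : (Σ i, Fin (r i)) → ℝ) (l : ℕ) (m : ι l) :
    coef Y (toL2 (spline ψ u α)) l m =
      (D l ^ 2)⁻¹ * ∑ a, α a / √(r a.1 : ℝ) * Y l m (u a.1 a.2) := by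
  rw [toL2_spline, coef_sum, Finset.mul_sum]
  refine Finset.sum_congr rfl fun a _ => ?_
  rw [coef_smul, (isZonalGreenKernel_iff hY hD hp ψ).1 hψ]
  ring

/-- The reproducing property of the Green's kernel for the inner product `⟨𝒟 f, 𝒟 g⟩`. -/
theorem inner_op_spline (hY : IsHarmonicBasis Y) (hD : IsAdmissible D p) (hp : 1 < p)
    (hψ : IsZonalGreenKernel Y (adjMul D) ψ) (α : (Σ i, Fin (r i)) → ℝ) {f : L2}
    (hf : f ∈ sobolev Y p) : ⟪op Y D (toL2 (spline ψ u α)), op Y D f⟫ =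
      ∑ a, α a / √(r a.1 : ℝ) * pointEval f (u a.1 a.2) := by
  refine (hY.hasSum_inner _ _).unique ?_
  have h : HasSum (fun l => ∑ a : Σ i, Fin (r i), α a / √(r a.1 : ℝ) *
      ∑ m, coef Y f l m * Y l m (u a.1 a.2))
      (∑ a, α a / √(r a.1 : ℝ) * pointEval f (u a.1 a.2)) :=
    hasSum_sum fun a _ => (hasSum_pointEval hY hp hf (u a.1 a.2)).mul_left _
  convert! h using 1
  funext l
  have hl := hD.2.1 l
  simp only [coef_op_of_mem hY hD hf,
    coef_op_of_mem hY hD (spline_mem_sobolev hY hD hp hψ α), coef_spline hY hD hp hψ]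
  simp only [Finset.mul_sum, Finset.sum_mul]
  rw [Finset.sum_comm]
  refine Finset.sum_congr rfl fun a _ => Finset.sum_congr rfl fun m _ => ?_
  field_simp

/-- Up to normalization, the Gram matrix maps the coefficients of a spline to its values at the
nodes. -/
theorem gram_mulVec (α : (Σ i, Fin (r i)) → ℝ) (a : Σ i, Fin (r i)) :
    (gram ψ u).mulVec α a = pointEval (toL2 (spline ψ u α)) (u a.1 a.2) / √(r a.1 : ℝ) := by
  rw [pointEval_toL2, spline_apply, Finset.sum_div]
  refine Finset.sum_congr rfl fun b _ => ?_
  change ψ (dot (u a.1 a.2) (u b.1 b.2)) / √((r a.1 : ℝ) * r b.1) * α b = _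
  rw [Real.sqrt_mul (Nat.cast_nonneg _)]
  ring

theorem isUnit_gram_add (hY : IsHarmonicBasis Y) (hD : IsAdmissible D p) (hp : 1 < p)
    (hψ : IsZonalGreenKernel Y (adjMul D) ψ) {c : ℝ} (hc : 0 < c) :
    IsUnit (gram ψ u + c • (1 : Matrix _ _ ℝ)) := by
  rw [← Matrix.mulVec_injective_iff_isUnit]
  refine (injective_iff_map_eq_zero (Matrix.mulVecLin (gram ψ u + c • 1))).2 fun x hx => ?_
  -- the Gram matrix is positive semidefinite
  have h1 : x ⬝ᵥ (gram ψ u).mulVec x = ‖op Y D (toL2 (spline ψ u x))‖ ^ 2 := by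
    rw [← real_inner_self_eq_norm_sq,
      inner_op_spline hY hD hp hψ x (spline_mem_sobolev hY hD hp hψ x)]
    refine Finset.sum_congr rfl fun a _ => ?_
    rw [gram_mulVec]
    ring
  have h2 : x ⬝ᵥ (gram ψ u).mulVec x + c * (x ⬝ᵥ x) = 0 := by
    have := congrArg (x ⬝ᵥ ·) hx
    simpa [Matrix.add_mulVec, Matrix.smul_mulVec, dotProduct_add] using this
  have h3 : 0 ≤ x ⬝ᵥ x := Finset.sum_nonneg fun a _ => mul_self_nonneg _
  have h4 : x ⬝ᵥ x = 0 := by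
    have := sq_nonneg ‖op Y D (toL2 (spline ψ u x))‖
    nlinarith
  exact dotProduct_self_eq_zero.1 h4

/-- Zonal Green's functions at distinct points are linearly independent. -/
theorem toL2_spline_injective (hY : IsHarmonicBasis Y) (hD : IsAdmissible D p) (hp : 1 < p)
    (hψ : IsZonalGreenKernel Y (adjMul D) ψ) (hr : ∀ i, 1 ≤ r i)
    (hu : Function.Injective fun a : Σ i, Fin (r i) => u a.1 a.2) :
    Function.Injective fun α => toL2 (spline ψ u α) := by
  intro α β h
  have hz := eq_zero_of_sum_harmonics_eq_zero hY hu
    (β := fun a => (α a - β a) / √(r a.1 : ℝ)) fun l m => by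
      have e := congrArg (fun f => coef Y f l m) h
      have hl : (D l ^ 2)⁻¹ ≠ 0 := inv_ne_zero (pow_ne_zero _ (hD.2.1 l))
      simp only [coef_spline hY hD hp hψ] at e
      have := mul_left_cancel₀ hl e
      simp only [sub_div, sub_mul, Finset.sum_sub_distrib, this, sub_self]
  funext a
  have hra : √(r a.1 : ℝ) ≠ 0 :=
    (Real.sqrt_pos.2 (Nat.cast_pos.2 (hr a.1))).ne'
  have := congrFun hz a
  exact sub_eq_zero.1 ((div_eq_zero_iff.1 this).resolve_right hra)

/-! ### The penalized least-squares problem -/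

theorem cost_eq (w : ∀ i, Fin (r i) → ℝ) (η : ℝ) (f : L2) : cost Y D w u η f =
    4 * Real.pi / n * ∑ a : Σ i, Fin (r i),
      1 / (r a.1 : ℝ) * (w a.1 a.2 - pointEval f (u a.1 a.2)) ^ 2 + η * ‖op Y D f‖ ^ 2 := by
  rw [cost, Fintype.sum_sigma]
  simp only [Finset.mul_sum]

/-- If the coefficients solve the linear system, the cost at a perturbation of the spline exceeds
the cost at the spline by a quadratic form in the perturbation: by the reproducing property the
two cross terms cancel. -/
theorem cost_spline_add (hY : IsHarmonicBasis Y) (hD : IsAdmissible D p) (hp : 1 < p)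
    (hψ : IsZonalGreenKernel Y (adjMul D) ψ) (hn : 1 ≤ n) (hr : ∀ i, 1 ≤ r i)
    (w : ∀ i, Fin (r i) → ℝ) (η : ℝ) {α : (Σ i, Fin (r i)) → ℝ}
    (hα : (gram ψ u + (η * n / (4 * Real.pi)) • (1 : Matrix _ _ ℝ)).mulVec α = obs w)
    {h : L2} (hh : h ∈ sobolev Y p) :
    cost Y D w u η (toL2 (spline ψ u α) + h) = cost Y D w u η (toL2 (spline ψ u α)) +
      (4 * Real.pi / n * ∑ a : Σ i, Fin (r i), 1 / (r a.1 : ℝ) * pointEval h (u a.1 a.2) ^ 2 +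
        η * ‖op Y D h‖ ^ 2) := by
  have hμ := spline_mem_sobolev (u := u) hY hD hp hψ α
  have hn0 : (n : ℝ) ≠ 0 := by positivity
  have hpi := Real.pi_ne_zero
  -- the weighted residuals at the nodes are multiples of the coefficients
  have hres (a : Σ i, Fin (r i)) : 1 / (r a.1 : ℝ) *
      (w a.1 a.2 - pointEval (toL2 (spline ψ u α)) (u a.1 a.2)) =
      η * n / (4 * Real.pi) * (α a / √(r a.1 : ℝ)) := by
    have e := congrFun hα a
    have hra : 0 < √(r a.1 : ℝ) := Real.sqrt_pos.2 (Nat.cast_pos.2 (hr a.1))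
    rw [Matrix.add_mulVec, Pi.add_apply, gram_mulVec, Matrix.smul_mulVec, Matrix.one_mulVec,
      Pi.smul_apply, smul_eq_mul, obs] at e
    have e' : η * n / (4 * Real.pi) * α a =
        (w a.1 a.2 - pointEval (toL2 (spline ψ u α)) (u a.1 a.2)) / √(r a.1 : ℝ) := by
      rw [sub_div, ← e]; ring
    rw [← mul_div_assoc, e', div_div, Real.mul_self_sqrt (Nat.cast_nonneg _)]
    ring
  rw [cost_eq, cost_eq, op_add hY hD hμ hh, norm_add_sq_real, inner_op_spline hY hD hp hψ α hh]
  have hsum : ∑ a : Σ i, Fin (r i), 1 / (r a.1 : ℝ) *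
      (w a.1 a.2 - pointEval (toL2 (spline ψ u α) + h) (u a.1 a.2)) ^ 2 =
      ∑ a : Σ i, Fin (r i), 1 / (r a.1 : ℝ) *
        (w a.1 a.2 - pointEval (toL2 (spline ψ u α)) (u a.1 a.2)) ^ 2 -
      2 * (η * n / (4 * Real.pi)) *
        ∑ a, α a / √(r a.1 : ℝ) * pointEval h (u a.1 a.2) +
      ∑ a : Σ i, Fin (r i), 1 / (r a.1 : ℝ) * pointEval h (u a.1 a.2) ^ 2 := by
    rw [Finset.mul_sum, ← Finset.sum_sub_distrib, ← Finset.sum_add_distrib]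
    refine Finset.sum_congr rfl fun a _ => ?_
    rw [pointEval_add hY hp hμ hh]
    linear_combination (-2 * pointEval h (u a.1 a.2)) * hres a
  rw [hsum]
  field_simp
  ring

end Splines

end SphereMean

end

open SphereMean
theorem theorem4p1 {ι : ℕ → Type} [∀ l, Fintype (ι l)] (Y : ∀ l, ι l → C(S2, ℝ))
    (hY : IsHarmonicBasis Y) (D : ℕ → ℝ) (p : ℝ) (hD : IsAdmissible D p) (hp : 1 < p)
    (n : ℕ) (hn : 1 ≤ n) (r : Fin n → ℕ) (hr : ∀ i, 1 ≤ r i)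
    (w : ∀ i, Fin (r i) → ℝ) (u : ∀ i, Fin (r i) → S2)
    (hu : Function.Injective fun a : Σ i, Fin (r i) => u a.1 a.2)
    (η : ℝ) (hη : 0 < η) :
    -- point values make sense on the Sobolev space
    (∀ f ∈ sobolev Y p, ∃! g : C(S2, ℝ), toL2 g = f) ∧
    -- the zonal Green's kernel exists and is unique
    (∃! ψ : C(Set.Icc (-1 : ℝ) 1, ℝ), IsZonalGreenKernel Y (adjMul D) ψ) ∧
    ∀ ψ : C(Set.Icc (-1 : ℝ) 1, ℝ), IsZonalGreenKernel Y (adjMul D) ψ →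
      IsUnit (gram ψ u + (η * n / (4 * Real.pi)) • (1 : Matrix _ _ ℝ)) ∧
      ∃ μ : L2,
        (μ ∈ sobolev Y p ∧ IsMinOn (cost Y D w u η) (sobolev Y p) μ) ∧
        (∀ ν : L2, ν ∈ sobolev Y p ∧ IsMinOn (cost Y D w u η) (sobolev Y p) ν → ν = μ) ∧
        ∀ α : (Σ i, Fin (r i)) → ℝ,
          μ = toL2 (spline ψ u α) ↔
            α = Matrix.mulVec
              (gram ψ u + (η * n / (4 * Real.pi)) • (1 : Matrix _ _ ℝ))⁻¹ (obs w) := by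
  refine ⟨fun f hf => ?_, existsUnique_isZonalGreenKernel hY hD hp, fun ψ hψ => ?_⟩
  · obtain ⟨g, hg⟩ := exists_representative hY hp hf
    exact ⟨g, hg, fun g' hg' => toL2_injective (hg'.trans hg.symm)⟩
  have hn0 : (0 : ℝ) < n := by exact_mod_cast hn
  have hM : IsUnit (gram ψ u + (η * n / (4 * Real.pi)) • (1 : Matrix _ _ ℝ)) :=
    isUnit_gram_add hY hD hp hψ (by positivity)
  refine ⟨hM, ?_⟩
  set M := gram ψ u + (η * n / (4 * Real.pi)) • (1 : Matrix _ _ ℝ) with hMdef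
  have hα : M.mulVec (M⁻¹.mulVec (obs w)) = obs w := by
    rw [Matrix.mulVec_mulVec, Matrix.mul_nonsing_inv _ ((Matrix.isUnit_iff_isUnit_det _).1 hM),
      Matrix.one_mulVec]
  have hμ := spline_mem_sobolev (u := u) hY hD hp hψ (M⁻¹.mulVec (obs w))
  set μ := toL2 (spline ψ u (M⁻¹.mulVec (obs w))) with hμdef
  have hcost {f : L2} (hf : f ∈ sobolev Y p) :
      cost Y D w u η μ + η * ‖op Y D (f - μ)‖ ^ 2 ≤ cost Y D w u η f ∧ f - μ ∈ sobolev Y p := by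
    have hs : f - μ ∈ sobolev Y p := by
      rw [sub_eq_add_neg, ← neg_one_smul ℝ μ]
      exact add_mem_sobolev hf (smul_mem_sobolev _ hμ)
    have h := cost_spline_add (u := u) hY hD hp hψ hn hr w η hα hs
    rw [← hμdef, add_sub_cancel] at h
    refine ⟨?_, hs⟩
    rw [h]
    have : 0 ≤ 4 * Real.pi / n *
        ∑ a : Σ i, Fin (r i), 1 / (r a.1 : ℝ) * pointEval (f - μ) (u a.1 a.2) ^ 2 := by
      positivity
    linarith
  refine ⟨μ, ⟨hμ, fun f hf => ?_⟩, ?_, fun α => ⟨fun h => ?_, fun h => by rw [h]⟩⟩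
  · have := (hcost hf).1
    have h0 : 0 ≤ η * ‖op Y D (f - μ)‖ ^ 2 := by positivity
    exact (le_add_of_nonneg_right h0).trans this
  · rintro ν ⟨hν, hmin⟩
    obtain ⟨h1, h2⟩ := hcost hν
    have h3 : cost Y D w u η ν ≤ cost Y D w u η μ := hmin hμ
    have h4 : ‖op Y D (ν - μ)‖ ^ 2 ≤ 0 := by
      refine le_of_mul_le_mul_left ?_ hη
      linarith
    have h5 : op Y D (ν - μ) = 0 :=
      norm_eq_zero.1 (pow_eq_zero_iff two_ne_zero |>.1 (le_antisymm h4 (sq_nonneg _)))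
    exact sub_eq_zero.1 (eq_zero_of_op_eq_zero hY hD h2 h5)
  · exact (toL2_spline_injective hY hD hp hψ hr hu h).symm
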